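/- Let $G=(A,B,E)$ be a finite bipartite graph in which every edge $e\in E\subseteq A\times B$ has a weight $w(e)\in\mathbb R$ and exists independently with probability $p_e\in[0,1]$. A \emph{query-commit algorithm} adaptively (and possibly using internal randomness, independent of the edges) queries edges. A queried edge that exists must be added to the current matching $M$ (initially empty), and an edge sharing an endpoint with an edge of the current $M$ may not be queried. The output is the set $M$ of queried edges that exist; the expected utility $\mathcal U(\mathcal A)$ of an algorithm $\mathcal A$ is the expected value of $\sum_{e\in M}w(e)$. Let $\mathrm{OPT}=\max_{\mathcal A}\mathcal U(\mathcal A)$ over all query-commit algorithms. For $u\in A\cup B$ let $E_u$ be the set of edges incident to $u$, and for $F\subseteq E$ let $f(F)=1-\prod_{e\in F}(1-p_e)$. Let $\mathrm{LP}$ be the linear program $$\text{maximize }\sum_{e\in E}x_e w(e)\ \text{ subject to }\ \sum_{e\in F}x_e\le f(F)\ \ (u\in A\cup B,\ F\subseteq E_u),\qquad x_e\ge 0\ \ (e\in E).$$ For $a\in A$ let $P_a=\{y\in\mathbb R_{\ge0}^{E_a}:\sum_{e\in F}y_e\le f(F)\ \text{for all }F\subseteq E_a\}$. For an extreme point $y$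 of $P_a$, a \emph{chain order} of $y$ is an ordering $\sigma_y=(e_1,\dots,e_k)$ of $\{e\in E_a:y_e>0\}$ such that $\sum_{j\le i}y_{e_j}=f(\{e_1,\dots,e_i\})$ for every $i\le k$. The algorithm \textbf{Approx-QC} is the following. \begin{enumerate} \item Find an optimal solution $x^*$ of $\mathrm{LP}$. For each $a\in A$ write the restriction of $x^*$ to $E_a$ as a convex combination $\sum_{i}\alpha_i y^{(i)}$ of finitely many extreme points of $P_a$, and let $\mathcal D_a$ be the distribution that gives a chain order $\sigma_{y^{(i)}}$ with probability $\alpha_i$. For each $b\in B$ let $c_b=\sum_{e\in E_b}x^*_e w(e)$. \item Draw independent arrival times $t_a$, $a\in A$, uniformly from $[0,1]$. Start with $M=\emptyset$. \item For each $a\in A$ in increasing order of $t_a$, draw independently $\sigma$ from $\mathcal D_a$ and go through the edges $e=(a,b)$ in the order of $\sigma$. If $w(e)\ge(1-e^{t_a-1})\,c_b$ and $b$ is not matched by $M$, query $e$, and if it exists, add it to $M$ and continue with the next vertex of $A$. Otherwise flip an independent coin with heads probability $p_e$, and on heads continue with the next vertex of $A$. \item Return $M$. \end{enumerate} \textbf{Theorem.}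 The maximum $\mathrm{OPT}$ is attained. There are an optimal solution $x^*$ of $\mathrm{LP}$ and distributions $\mathcal D_a$ as in step 1, and for every choice of these, Approx-QC is a query-commit algorithm with $$\mathcal U(\text{Approx-QC})\ \ge\ \Bigl(1-\frac1e\Bigr)\cdot\mathrm{OPT}.$$ -/

import Mathlib

open MeasureTheory ProbabilityTheory

/-- A weighted bipartite graph with vertex sides `A` and `B`, in which every edge `e` has a weight
and an existence probability in `[0, 1]`. -/
structure QCGraph (A B : Type*) where
  edges : Finset (A × B)
  weight : edges → ℝ
  prob : edges → unitInterval

/-- Deterministic adaptive querying strategies: either stop, or query an edge and continue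
with the first subtree if the edge exists and with the second one if it does not. -/
inductive QueryTree (E : Type*) where
  | halt : QueryTree E
  | query (e : E) (ifExists ifNot : QueryTree E) : QueryTree E

namespace QueryTree

/-- The discrete sigma-algebra on strategies. -/
instance {E : Type*} : MeasurableSpace (QueryTree E) := ⊤

/-- The set of queried edges that exist when the existence indicators are `ω`. -/
def output {E : Type*} [DecidableEq E] : QueryTree E → (E → Bool) → Finset E
  | halt, _ => ∅
  | query e T₁ T₂, ω => if ω e then insert e (T₁.output ω) else T₂.output ω

end QueryTree

namespace QCGraph

variable {A B : Type*}

/-- The type of edges. -/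
abbrev Edge (G : QCGraph A B) : Type _ := {e : A × B // e ∈ G.edges}

/-- The end point of an edge in `A`. -/
abbrev left {G : QCGraph A B} (e : G.Edge) : A := e.1.1

/-- The end point of an edge in `B`. -/
abbrev right {G : QCGraph A B} (e : G.Edge) : B := e.1.2

/-- When the current matching is `M`, the strategy `T` only ever queries edges that do not
intersect the current matching, where each queried edge that exists has to be added to it. -/
def Commits (G : QCGraph A B) [DecidableEq A] [DecidableEq B] :
    Finset G.Edge → QueryTree G.Edge → Prop
  | _, .halt => True
  | M, .query e T₁ T₂ =>
      (∀ e' ∈ M, left e' ≠ left e ∧ right e' ≠ right e) ∧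
        G.Commits (insert e M) T₁ ∧ G.Commits M T₂

/-- The law of independent bits, one for each edge `e`, the bit of `e` being `true` with
probability `p_e`. -/
noncomputable def bitLaw (G : QCGraph A B) : Measure (G.Edge → Bool) :=
  Measure.pi fun e => bernoulliMeasure true false (G.prob e)

variable [DecidableEq A] [DecidableEq B]

/-- A (possibly randomized) query-commit algorithm, given as a probability distribution over
deterministic strategies that respect the query-commit rule. -/
def IsQueryCommit (G : QCGraph A B) (μ : Measure (QueryTree G.Edge)) : Prop :=
  IsProbabilityMeasure μ ∧ ∀ᵐ T ∂μ, G.Commits ∅ T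

/-- Expected weight of the output, over the internal randomness `T` and the existence of the
edges `ω`, which are independent. -/
noncomputable def utility (G : QCGraph A B) (μ : Measure (QueryTree G.Edge)) : ℝ :=
  ∫ T, (∫ ω, ∑ e ∈ T.output ω, G.weight e ∂G.bitLaw) ∂μ

/-- The expected utilities of all query-commit algorithms. -/
def utilities (G : QCGraph A B) : Set ℝ :=
  {u | ∃ μ : Measure (QueryTree G.Edge), G.IsQueryCommit μ ∧ G.utility μ = u}

/-- The optimal expected query-commit utility. -/
noncomputable def opt (G : QCGraph A B) : ℝ := sSup G.utilities

/-- The set of edges incident to a vertex on either side. -/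
def incident (G : QCGraph A B) : A ⊕ B → Finset G.Edge
  | .inl a => Finset.univ.filter fun e => left e = a
  | .inr b => Finset.univ.filter fun e => right e = b

/-- The probability that at least one edge of `F` exists. -/
def existProb (G : QCGraph A B) (F : Finset G.Edge) : ℝ := 1 - ∏ e ∈ F, (1 - (G.prob e : ℝ))

/-- The feasible region of the linear program. -/
def lpFeasible (G : QCGraph A B) : Set (G.Edge → ℝ) :=
  {x | (∀ u : A ⊕ B, ∀ F ⊆ G.incident u, ∑ e ∈ F, x e ≤ G.existProb F) ∧ ∀ e, 0 ≤ x e}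

/-- The optimal solutions of the linear program. -/
def IsLPOptimal (G : QCGraph A B) (x : G.Edge → ℝ) : Prop :=
  x ∈ G.lpFeasible ∧ IsMaxOn (fun x => ∑ e, x e * G.weight e) G.lpFeasible x

/-- The polytope of a vertex `a`, defined by the constraints for subsets of `E_a`. The space of
vectors indexed by `E_a` is identified with the vectors on all edges that vanish off `E_a`. -/
def vertexPolytope (G : QCGraph A B) (a : A) : Set (G.Edge → ℝ) :=
  {y | (∀ e ∉ G.incident (.inl a), y e = 0) ∧
    (∀ F ⊆ G.incident (.inl a), ∑ e ∈ F, y e ≤ G.existProb F) ∧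
    ∀ e ∈ G.incident (.inl a), 0 ≤ y e}

/-- The permutations of subsets of `E_a`. -/
def EdgeOrder (G : QCGraph A B) (a : A) : Type _ :=
  {l : List G.Edge // l.Nodup ∧ ∀ e ∈ l, e ∈ G.incident (.inl a)}

instance (G : QCGraph A B) (a : A) : MeasurableSpace (G.EdgeOrder a) := ⊤

/-- `σ = (e_1, …, e_k)` enumerates the support of `y` in such a way that the constraint of every
initial segment `{e_1, …, e_i}` is tight at `y`. -/
def IsChainOrder (G : QCGraph A B) {a : A} (y : G.Edge → ℝ) (σ : G.EdgeOrder a) : Prop :=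
  (∀ e, e ∈ σ.1 ↔ 0 < y e) ∧
    ∀ i ≤ σ.1.length,
      ∑ e ∈ (σ.1.take i).toFinset, y e = G.existProb (σ.1.take i).toFinset

/-- `D` is a distribution obtained by writing the restriction of `x` to `E_a` as a convex
combination of extreme points of the polytope of `a`, choosing one of these extreme points with
probability its coefficient, and taking the order given by the chain of its tight sets. -/
def IsPermDist (G : QCGraph A B) (x : G.Edge → ℝ) (a : A) (D : PMF (G.EdgeOrder a)) : Prop :=
  ∃ (k : ℕ) (c : PMF (Fin k)) (y : Fin k → G.Edge → ℝ) (σ : Fin k → G.EdgeOrder a),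
    (∀ i, y i ∈ (G.vertexPolytope a).extremePoints ℝ) ∧
    (∀ e ∈ G.incident (.inl a), x e = ∑ i, (c i).toReal * y i e) ∧
    (∀ i, G.IsChainOrder (y i) (σ i)) ∧
    D = c.map σ

/-- The base price `c_b`. -/
noncomputable def basePrice (G : QCGraph A B) (x : G.Edge → ℝ) (b : B) : ℝ :=
  ∑ e ∈ G.incident (.inr b), x e * G.weight e

/-- The inner loop: process the given list of edges at a vertex with arrival time `t`, when the
current matching is `M`, and then go on with `next` from the resulting matching. The coin of
an edge is only used when the edge is not queried. -/
noncomputable def processVertex (G : QCGraph A B) (x : G.Edge → ℝ) (coin : G.Edge → Bool)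
    (t : ℝ) (M : Finset G.Edge) (next : Finset G.Edge → QueryTree G.Edge) :
    List G.Edge → QueryTree G.Edge
  | [] => next M
  | e :: l =>
      if (1 - Real.exp (t - 1)) * G.basePrice x (right e) ≤ G.weight e ∧
          (∀ e' ∈ M, right e' ≠ right e) then
        .query e (next (insert e M)) (G.processVertex x coin t M next l)
      else if coin e then next M
      else G.processVertex x coin t M next l

/-- The outer loop, over a list of vertices of `A`. -/
noncomputable def processAll (G : QCGraph A B) (x : G.Edge → ℝ) (coin : G.Edge → Bool)
    (t : A → unitInterval) (σ : ∀ a, G.EdgeOrder a) :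
    List A → Finset G.Edge → QueryTree G.Edge
  | [], _ => .halt
  | a :: l, M =>
      G.processVertex x coin (t a) M (fun M' => G.processAll x coin t σ l M') (σ a).1

variable [Fintype A]

/-- The strategy followed by Approx-QC for given internal randomness: arrival times `t`, orders
`σ a` and coins. The vertices of `A` are handled in increasing order of arrival time. -/
noncomputable def approxQCStrategy (G : QCGraph A B) (x : G.Edge → ℝ)
    (r : (A → unitInterval) × (∀ a, G.EdgeOrder a) × (G.Edge → Bool)) : QueryTree G.Edge :=
  G.processAll x r.2.2 r.1 r.2.1
    ((Finset.univ : Finset A).toList.mergeSort fun a a' => decide (r.1 a ≤ r.1 a')) ∅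

/-- The randomized algorithm Approx-QC, run with the solution `x` of the linear program and the
distributions `D a`: arrival times are independent and uniform on `[0, 1]`, the orders `σ a` are
drawn independently from `D a`, and the coin of `e` shows heads with probability `p_e`. -/
noncomputable def approxQC (G : QCGraph A B) (x : G.Edge → ℝ) (D : ∀ a, PMF (G.EdgeOrder a)) :
    Measure (QueryTree G.Edge) :=
  ((Measure.pi fun _ : A => (volume : Measure unitInterval)).prod
    ((Measure.pi fun a => (D a).toMeasure).prod G.bitLaw)).map (G.approxQCStrategy x)

end QCGraph

/-! The LP value bounds OPT from above, and Approx-QC earns at least (1 - 1/e) c_b at every b; the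
c_b add up to the LP value.

Upper bound. A randomized algorithm is a mixture of deterministic trees, and the marginals P(e ∈ M)
of a tree are LP-feasible: M is a matching of existing edges, so it holds at most one edge of F ⊆
E_u, and none unless some edge of F exists (`exists_lpFeasible_eq_treeUtility`).

Selection at a. Since f is submodular, the tight sets of a point of P_a are closed under union and
intersection, and for an extreme point they contain a maximal chain in its support
(`exists_insert_tight`). Tightness along this chain says that y_e is the probability that e is the
first existing edge in the chain order. Hence an order drawn from D_a selects e with probability
x*_e. The coin of a skipped edge stands in for its existence, so this law does not depend on which
edges are queried (`coinGain_processVertex`).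

Decoupling. Each b thus faces buyers a who arrive at independent uniform times, want b with
probability x*_(a,b), and pay w(a,b) if b is free and the price is met. The expected utility is the
sum over b of these sales (`orderGain_processAll`).

One item (`le_sum_integral_rate`). Let p(s) = (1 - e^(s-1)) c be the price and r(s) the probability
that no buyer has accepted by time s. As p' = p - c, the rate of expected gain is at least -(p r)'.
Integrating over [0, 1] gives p(0) r(0) - p(1) r(1) = (1 - 1/e) c. -/

namespace QCGraph

/-! ### Independent existence bits -/

section Bits

variable {A B : Type*}

instance isProbabilityMeasure_bitLaw (G : QCGraph A B) : IsProbabilityMeasure G.bitLaw := by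
  unfold bitLaw; infer_instance

/-- Edges of a set are simultaneously absent with the product of their absence probabilities. -/
theorem bitLaw_real_forall_false (G : QCGraph A B) (F : Finset G.Edge) :
    G.bitLaw.real {ω | ∀ e ∈ F, ω e = false} = ∏ e ∈ F, (1 - (G.prob e : ℝ)) := by
  classical
  have h : {ω : G.Edge → Bool | ∀ e ∈ F, ω e = false} =
      Set.pi Set.univ fun e => if e ∈ F then {false} else Set.univ := by
    ext ω
    simp only [Set.mem_ofPred_eq, Set.mem_pi, Set.mem_univ, true_imp_iff]
    refine forall_congr' fun e => ?_
    split_ifs with he <;> simp [he]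
  rw [measureReal_def, h, bitLaw, Measure.pi_pi, ENNReal.toReal_prod,
    ← Finset.prod_subset (Finset.subset_univ F)]
  · refine Finset.prod_congr rfl fun e he => ?_
    rw [if_pos he, ← measureReal_def,
      bernoulliMeasure_real_apply_of_notMem_of_mem _ (by simp) (by simp) (by simp)]
  · intro e _ he
    simp [he]

theorem bitLaw_real_exists_true (G : QCGraph A B) (F : Finset G.Edge) :
    G.bitLaw.real {ω | ∃ e ∈ F, ω e = true} = G.existProb F := by
  have h : {ω : G.Edge → Bool | ∃ e ∈ F, ω e = true} = {ω | ∀ e ∈ F, ω e = false}ᶜ := by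
    ext ω; simp
  rw [h, probReal_compl_eq_one_sub (Set.toFinite _).measurableSet, bitLaw_real_forall_false,
    existProb]

theorem existProb_le_one (G : QCGraph A B) (F : Finset G.Edge) : G.existProb F ≤ 1 := by
  rw [← bitLaw_real_exists_true]
  exact measureReal_le_one

theorem existProb_nonneg (G : QCGraph A B) (F : Finset G.Edge) : 0 ≤ G.existProb F := by
  rw [← bitLaw_real_exists_true]
  exact measureReal_nonneg

end Bits

/-! ### Deterministic strategies, attainment of OPT, and the LP upper bound -/

variable {A B : Type*} [DecidableEq A] [DecidableEq B]

theorem _root_.QueryTree.eq_true_of_mem_output {E : Type*} [DecidableEq E] (T : QueryTree E)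
    {ω : E → Bool} {e : E} (h : e ∈ T.output ω) : ω e = true := by
  induction T with
  | halt => simp [QueryTree.output] at h
  | query e' T₁ T₂ ih₁ ih₂ =>
    rw [QueryTree.output] at h
    split_ifs at h with he
    · rcases Finset.mem_insert.1 h with rfl | h
      · exact he
      · exact ih₁ h
    · exact ih₂ h

/-- The output of a committing strategy is vertex-disjoint from the current matching. -/
theorem Commits.disjoint_output (G : QCGraph A B) {T : QueryTree G.Edge} {M : Finset G.Edge}
    (hT : G.Commits M T) (ω : G.Edge → Bool) {e e' : G.Edge} (he : e ∈ T.output ω) (he' : e' ∈ M) :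
    left e' ≠ left e ∧ right e' ≠ right e := by
  induction T generalizing M with
  | halt => simp [QueryTree.output] at he
  | query e₀ T₁ T₂ ih₁ ih₂ =>
    obtain ⟨h, h₁, h₂⟩ := hT
    rw [QueryTree.output] at he
    split_ifs at he with h₀
    · rcases Finset.mem_insert.1 he with rfl | he
      · exact h e' he'
      · exact ih₁ h₁ he (Finset.mem_insert_of_mem he')
    · exact ih₂ h₂ he he'

/-- The output of a committing strategy is a matching. -/
theorem Commits.isMatching_output (G : QCGraph A B) {T : QueryTree G.Edge} {M : Finset G.Edge}
    (hT : G.Commits M T) (ω : G.Edge → Bool) {e e' : G.Edge} (he : e ∈ T.output ω)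
    (he' : e' ∈ T.output ω) (hne : e ≠ e') : left e ≠ left e' ∧ right e ≠ right e' := by
  induction T generalizing M with
  | halt => simp [QueryTree.output] at he
  | query e₀ T₁ T₂ ih₁ ih₂ =>
    obtain ⟨h, h₁, h₂⟩ := hT
    rw [QueryTree.output] at he he'
    split_ifs at he he' with h₀
    · rcases Finset.mem_insert.1 he with he | he <;> rcases Finset.mem_insert.1 he' with he' | he'
      · exact absurd (he.trans he'.symm) hne
      · exact he ▸ h₁.disjoint_output G ω he' (Finset.mem_insert_self _ _)
      · have := h₁.disjoint_output G ω he (Finset.mem_insert_self _ _)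
        exact he' ▸ ⟨this.1.symm, this.2.symm⟩
      · exact ih₁ h₁ he he'
    · exact ih₂ h₂ he he'

/-- The expected weight of the output of a deterministic strategy. -/
noncomputable def treeUtility (G : QCGraph A B) (T : QueryTree G.Edge) : ℝ :=
  ∫ ω, ∑ e ∈ T.output ω, G.weight e ∂G.bitLaw

/-- There are infinitely many trees, but the utility depends only on the output map, an element of a
finite type. This makes the optimum attained and all utilities integrable. -/
theorem finite_range_treeUtility (G : QCGraph A B) : (Set.range G.treeUtility).Finite := by
  refine (Set.finite_range fun f : (G.Edge → Bool) → Finset G.Edge =>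
    ∫ ω, ∑ e ∈ f ω, G.weight e ∂G.bitLaw).subset ?_
  rintro _ ⟨T, rfl⟩
  exact ⟨T.output, rfl⟩

theorem utility_eq (G : QCGraph A B) (μ : Measure (QueryTree G.Edge)) :
    G.utility μ = ∫ T, G.treeUtility T ∂μ := rfl

theorem measurable_treeUtility (G : QCGraph A B) : Measurable G.treeUtility :=
  fun _ _ => trivial

theorem integrable_treeUtility (G : QCGraph A B) (μ : Measure (QueryTree G.Edge))
    [IsFiniteMeasure μ] : Integrable G.treeUtility μ := by
  obtain ⟨C, hC⟩ := G.finite_range_treeUtility.isBounded.exists_norm_le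
  exact Integrable.of_bound G.measurable_treeUtility.aestronglyMeasurable C
    (ae_of_all _ fun T => hC _ ⟨T, rfl⟩)

theorem exists_isMaxOn_treeUtility (G : QCGraph A B) :
    ∃ T, G.Commits ∅ T ∧ ∀ T', G.Commits ∅ T' → G.treeUtility T' ≤ G.treeUtility T := by
  obtain ⟨_, ⟨T, hT, rfl⟩, h⟩ := Set.exists_max_image (G.treeUtility '' {T | G.Commits ∅ T}) id
    (G.finite_range_treeUtility.subset (Set.image_subset_range _ _))
    ⟨_, .halt, by simp [Commits], rfl⟩
  exact ⟨T, hT, fun T' hT' => h _ ⟨T', hT', rfl⟩⟩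

/-- Averaging over internal randomness cannot beat the best deterministic tree, and that tree is
itself an algorithm through its Dirac measure. -/
theorem exists_opt_eq_treeUtility (G : QCGraph A B) :
    IsGreatest G.utilities G.opt ∧ ∃ T, G.Commits ∅ T ∧ G.opt = G.treeUtility T := by
  obtain ⟨T, hT, hmax⟩ := G.exists_isMaxOn_treeUtility
  have hgr : IsGreatest G.utilities (G.treeUtility T) := by
    constructor
    · refine ⟨Measure.dirac T, ⟨inferInstance, ?_⟩, ?_⟩
      · rw [ae_dirac_iff (MeasurableSpace.measurableSet_top)]
        exact hT
      · rw [utility_eq, integral_dirac' _ _ G.measurable_treeUtility.stronglyMeasurable]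
    · rintro _ ⟨μ, ⟨hμ, hc⟩, rfl⟩
      calc G.utility μ ≤ ∫ _, G.treeUtility T ∂μ := by
            rw [utility_eq]
            exact integral_mono_ae (G.integrable_treeUtility μ) (integrable_const _)
              (hc.mono fun T' hT' => hmax T' hT')
        _ = G.treeUtility T := by simp
  have hopt : G.opt = G.treeUtility T := hgr.csSup_eq
  exact ⟨hopt ▸ hgr, T, hT, hopt⟩

/-- The utility of a committing strategy is the objective value of a feasible solution. -/
theorem exists_lpFeasible_eq_treeUtility (G : QCGraph A B) {T : QueryTree G.Edge}
    (hT : G.Commits ∅ T) :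
    ∃ x ∈ G.lpFeasible, G.treeUtility T = ∑ e, x e * G.weight e := by
  have hint : ∀ f : (G.Edge → Bool) → ℝ, Integrable f G.bitLaw := fun f => Integrable.of_finite
  have hx : ∀ e, G.bitLaw.real {ω | e ∈ T.output ω} =
      ∫ ω, (if e ∈ T.output ω then 1 else 0) ∂G.bitLaw := by
    intro e
    rw [← integral_indicator_one (Set.toFinite _).measurableSet]
    refine integral_congr_ae (ae_of_all _ fun ω => ?_)
    simp [Set.indicator_apply]
  refine ⟨fun e => G.bitLaw.real {ω | e ∈ T.output ω},
    ⟨fun u F hF => ?_, fun e => measureReal_nonneg⟩, ?_⟩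
  · rw [← bitLaw_real_exists_true, ← integral_indicator_one (Set.toFinite _).measurableSet]
    simp_rw [hx]
    rw [← integral_finsetSum _ fun _ _ => hint _]
    refine integral_mono (hint _) (hint _) fun ω => ?_
    simp only [Finset.sum_boole]
    -- All edges of F share the vertex u, while the output is a matching.
    have hle : (F.filter fun e => e ∈ T.output ω).card ≤ 1 := by
      refine Finset.card_le_one.2 fun e he e' he' => ?_
      simp only [Finset.mem_filter] at he he'
      by_contra hne
      have h := hT.isMatching_output G ω he.2 he'.2 hne
      have h₁ := hF he.1
      have h₂ := hF he'.1
      cases u <;> simp only [incident, Finset.mem_filter, Finset.mem_univ, true_and] at h₁ h₂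
      · exact h.1 (h₁.trans h₂.symm)
      · exact h.2 (h₁.trans h₂.symm)
    by_cases hω : ∃ e ∈ F, ω e = true
    · rw [Set.indicator_of_mem (by exact hω), Pi.one_apply]
      exact_mod_cast hle
    · rw [Set.indicator_of_notMem (by exact hω), Finset.filter_eq_empty_iff.2]
      · simp
      · exact fun e he h => hω ⟨e, he, T.eq_true_of_mem_output h⟩
  · simp_rw [hx, ← integral_mul_const]
    rw [treeUtility, ← integral_finsetSum _ fun _ _ => hint _]
    refine integral_congr_ae (ae_of_all _ fun ω => ?_)
    simp only [ite_mul, one_mul, zero_mul]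
    rw [Finset.sum_ite_mem, Finset.univ_inter]

theorem exists_isLPOptimal (G : QCGraph A B) : ∃ x, G.IsLPOptimal x := by
  have hclosed : IsClosed G.lpFeasible := by
    simp only [lpFeasible, Set.ofPred_and, Set.ofPred_forall]
    refine IsClosed.inter ?_ ?_
    · exact isClosed_iInter fun u => isClosed_iInter fun F => isClosed_iInter fun _ =>
        isClosed_le (by fun_prop) continuous_const
    · exact isClosed_iInter fun e => isClosed_le continuous_const (by fun_prop)
  have hsub : G.lpFeasible ⊆ Set.Icc 0 1 := by
    refine fun x hx => ⟨hx.2, fun e => ?_⟩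
    have := hx.1 (.inl (left e)) {e} (by simp [incident])
    rw [Finset.sum_singleton] at this
    exact this.trans (G.existProb_le_one _)
  have hcomp : IsCompact G.lpFeasible := isCompact_Icc.of_isClosed_subset hclosed hsub
  exact hcomp.exists_isMaxOn ⟨0, fun u F _ => by simpa using G.existProb_nonneg F, fun _ => le_rfl⟩
    (Continuous.continuousOn (by fun_prop))

/-- The constraints are downward closed, so setting one coordinate to zero stays feasible and cannot
raise the objective. Thus edges of negative weight carry no mass and base prices are nonnegative. -/
theorem IsLPOptimal.mul_weight_nonneg {G : QCGraph A B} {x : G.Edge → ℝ} (hx : G.IsLPOptimal x)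
    (e : G.Edge) : 0 ≤ x e * G.weight e := by
  have hfeas : Function.update x e 0 ∈ G.lpFeasible := by
    have hle : ∀ e', Function.update x e 0 e' ≤ x e' := by
      intro e'
      by_cases h : e' = e
      · subst h; simpa using hx.1.2 e'
      · simp [h]
    refine ⟨fun u F hF => (Finset.sum_le_sum fun e' _ => hle e').trans (hx.1.1 u F hF), fun e' => ?_⟩
    by_cases h : e' = e
    · subst h; simp
    · simpa [h] using hx.1.2 e'
  have h := hx.2 hfeas
  simp only [Set.mem_ofPred_eq] at h
  rw [← Finset.add_sum_erase _ _ (Finset.mem_univ e),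
    ← Finset.add_sum_erase _ (fun e => x e * G.weight e) (Finset.mem_univ e)] at h
  have heq : ∑ e' ∈ Finset.univ.erase e, Function.update x e 0 e' * G.weight e' =
      ∑ e' ∈ Finset.univ.erase e, x e' * G.weight e' :=
    Finset.sum_congr rfl fun e' he' => by simp [Finset.ne_of_mem_erase he']
  rw [heq] at h
  simpa using h

theorem opt_le_of_isLPOptimal {G : QCGraph A B} {x : G.Edge → ℝ} (hx : G.IsLPOptimal x) :
    G.opt ≤ ∑ e, x e * G.weight e := by
  obtain ⟨-, T, hT, hopt⟩ := G.exists_opt_eq_treeUtility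
  obtain ⟨y, hy, hy'⟩ := G.exists_lpFeasible_eq_treeUtility hT
  rw [hopt, hy']
  exact hx.2 hy

end QCGraph

/-! ### Submodularity, extreme points of P_a and their chains of tight sets -/

namespace QCGraph

section ExistProb

variable {A B : Type*} (G : QCGraph A B)

theorem one_sub_prob_mem (e : G.Edge) : 0 ≤ 1 - (G.prob e : ℝ) ∧ 1 - (G.prob e : ℝ) ≤ 1 :=
  ⟨sub_nonneg.2 (G.prob e).2.2, sub_le_self _ (G.prob e).2.1⟩

theorem prod_one_sub_prob_mem (F : Finset G.Edge) :
    0 ≤ ∏ e ∈ F, (1 - (G.prob e : ℝ)) ∧ ∏ e ∈ F, (1 - (G.prob e : ℝ)) ≤ 1 :=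
  ⟨Finset.prod_nonneg fun e _ => (G.one_sub_prob_mem e).1,
    Finset.prod_le_one (fun e _ => (G.one_sub_prob_mem e).1) fun e _ => (G.one_sub_prob_mem e).2⟩

theorem existProb_empty : G.existProb ∅ = 0 := by simp [existProb]

theorem existProb_mono {F H : Finset G.Edge} (h : F ⊆ H) : G.existProb F ≤ G.existProb H := by
  classical
  have h₁ := Finset.prod_sdiff (f := fun e => 1 - (G.prob e : ℝ)) h
  have h₂ := G.prod_one_sub_prob_mem (H \ F)
  have h₃ := G.prod_one_sub_prob_mem F
  rw [existProb, existProb, ← h₁]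
  nlinarith

/-- The gap is P (1 - α)(1 - β), where P, α, β are the absence probabilities of F ∩ H, F \ H and H \
F. -/
theorem existProb_union_add_inter_le [DecidableEq A] [DecidableEq B] (F H : Finset G.Edge) :
    G.existProb (F ∪ H) + G.existProb (F ∩ H) ≤ G.existProb F + G.existProb H := by
  have h₁ := Finset.prod_union_inter (f := fun e => 1 - (G.prob e : ℝ)) (s₁ := F) (s₂ := H)
  have hF := Finset.prod_sdiff (f := fun e => 1 - (G.prob e : ℝ))
    (Finset.inter_subset_left (s₁ := F) (s₂ := H))
  have hH := Finset.prod_sdiff (f := fun e => 1 - (G.prob e : ℝ))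
    (Finset.inter_subset_right (s₁ := F) (s₂ := H))
  have hU := Finset.prod_sdiff (f := fun e => 1 - (G.prob e : ℝ))
    (Finset.subset_union_right (s₁ := F) (s₂ := H))
  have hd : (F ∪ H) \ H = F \ (F ∩ H) := by ext; simp; tauto
  rw [hd, ← hH] at hU
  have h₂ := G.prod_one_sub_prob_mem (F \ (F ∩ H))
  have h₃ := G.prod_one_sub_prob_mem (H \ (F ∩ H))
  have h₄ := G.prod_one_sub_prob_mem (F ∩ H)
  simp only [existProb]
  rw [← hF, ← hH, ← hU]
  nlinarith [mul_nonneg h₄.1 (mul_nonneg (sub_nonneg.2 h₂.2) (sub_nonneg.2 h₃.2))]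

end ExistProb

variable {A B : Type*} [DecidableEq A] [DecidableEq B] {G : QCGraph A B} {a : A} {y : G.Edge → ℝ}

theorem nonneg_of_mem_vertexPolytope (hy : y ∈ G.vertexPolytope a) (e : G.Edge) : 0 ≤ y e := by
  by_cases he : e ∈ G.incident (.inl a)
  · exact hy.2.2 e he
  · exact (hy.1 e he).ge

theorem convex_vertexPolytope (G : QCGraph A B) (a : A) : Convex ℝ (G.vertexPolytope a) := by
  intro y hy z hz s t hs ht hst
  refine ⟨fun e he => by simp [hy.1 e he, hz.1 e he], fun F hF => ?_, fun e he => ?_⟩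
  · have h₁ := mul_le_mul_of_nonneg_left (hy.2.1 F hF) hs
    have h₂ := mul_le_mul_of_nonneg_left (hz.2.1 F hF) ht
    simp only [Pi.add_apply, Pi.smul_apply, smul_eq_mul, Finset.sum_add_distrib, ← Finset.mul_sum]
    calc _ ≤ s * G.existProb F + t * G.existProb F := add_le_add h₁ h₂
      _ = G.existProb F := by rw [← add_mul, hst, one_mul]
  · exact add_nonneg (mul_nonneg hs (hy.2.2 e he)) (mul_nonneg ht (hz.2.2 e he))

theorem isCompact_vertexPolytope (G : QCGraph A B) (a : A) : IsCompact (G.vertexPolytope a) := by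
  have hclosed : IsClosed (G.vertexPolytope a) := by
    simp only [vertexPolytope, Set.ofPred_and, Set.ofPred_forall]
    refine IsClosed.inter ?_ (IsClosed.inter ?_ ?_)
    · exact isClosed_iInter fun e => isClosed_iInter fun _ =>
        isClosed_eq (by fun_prop) continuous_const
    · exact isClosed_iInter fun F => isClosed_iInter fun _ =>
        isClosed_le (by fun_prop) continuous_const
    · exact isClosed_iInter fun e => isClosed_iInter fun _ =>
        isClosed_le continuous_const (by fun_prop)
  have hsub : G.vertexPolytope a ⊆ Set.Icc 0 1 := by
    refine fun y hy => ⟨nonneg_of_mem_vertexPolytope hy, fun e => ?_⟩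
    by_cases he : e ∈ G.incident (.inl a)
    · have := hy.2.1 {e} (by simpa using he)
      rw [Finset.sum_singleton] at this
      exact this.trans (G.existProb_le_one _)
    · simp [hy.1 e he]
  exact isCompact_Icc.of_isClosed_subset hclosed hsub

/-- A direction that vanishes off the support and along which all tight constraints of an extreme
point remain tight is zero. -/
theorem eq_zero_of_mem_extremePoints (hy : y ∈ (G.vertexPolytope a).extremePoints ℝ)
    {d : G.Edge → ℝ} (hd : ∀ e, y e = 0 → d e = 0)
    (ht : ∀ F ⊆ G.incident (.inl a), ∑ e ∈ F, y e = G.existProb F → ∑ e ∈ F, d e = 0) :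
    d = 0 := by
  -- Slack constraints survive a small perturbation by continuity; tight ones and zero coordinates
  -- are unchanged by hypothesis. Since ε may have either sign, y becomes a midpoint inside the
  -- polytope.
  have hev : ∀ᶠ ε : ℝ in nhds 0, y + ε • d ∈ G.vertexPolytope a := by
    have h₁ : ∀ e, ∀ᶠ ε : ℝ in nhds 0, 0 ≤ y e + ε * d e := by
      intro e
      rcases (nonneg_of_mem_vertexPolytope hy.1 e).eq_or_lt with h | h
      · simp [← h, hd e h.symm]
      · have hc : ContinuousAt (fun ε : ℝ => y e + ε * d e) 0 := by fun_prop
        exact (hc.eventually_const_lt (by simpa using h)).mono fun _ => le_of_lt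
    have h₂ : ∀ F : Finset G.Edge, ∀ᶠ ε : ℝ in nhds 0, F ⊆ G.incident (.inl a) →
        ∑ e ∈ F, (y e + ε * d e) ≤ G.existProb F := by
      intro F
      by_cases hF : F ⊆ G.incident (.inl a)
      · rcases (hy.1.2.1 F hF).eq_or_lt with h | h
        · refine Filter.Eventually.of_forall fun ε _ => ?_
          rw [Finset.sum_add_distrib, ← Finset.mul_sum, ht F hF h, mul_zero, add_zero, h]
        · have hc : ContinuousAt (fun ε : ℝ => ∑ e ∈ F, (y e + ε * d e)) 0 := by fun_prop
          exact (hc.eventually_lt_const (by simpa using h)).mono fun _ h' _ => h'.le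
      · exact Filter.Eventually.of_forall fun _ h => absurd h hF
    filter_upwards [Filter.eventually_all.2 h₁, Filter.eventually_all.2 h₂] with ε h₁ h₂
    refine ⟨fun e he => ?_, fun F hF => h₂ F hF, fun e _ => h₁ e⟩
    simp [hy.1.1 e he, hd e (hy.1.1 e he)]
  obtain ⟨δ, hδ, h⟩ := Metric.eventually_nhds_iff.1 hev
  have hp := h (y := δ / 2) (by rw [Real.dist_eq, sub_zero, abs_of_pos (by positivity)]; linarith)
  have hm := h (y := -(δ / 2))
    (by rw [Real.dist_eq, sub_zero, abs_neg, abs_of_pos (by positivity)]; linarith)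
  have hmem : y ∈ openSegment ℝ (y + (δ / 2) • d) (y + (-(δ / 2)) • d) :=
    ⟨1 / 2, 1 / 2, by norm_num, by norm_num, by norm_num, by ext e; simp; ring⟩
  have heq := hy.2 hp hm hmem
  have : (δ / 2) • d = 0 := by simpa using heq
  exact (smul_eq_zero.1 this).resolve_left (by positivity)

/-- Uncrossing: the sum of y is modular and f is submodular, so the two inequalities for union and
intersection have no slack left. -/
theorem tight_union_inter (hy : y ∈ G.vertexPolytope a) {F H : Finset G.Edge}
    (hF : F ⊆ G.incident (.inl a)) (hH : H ⊆ G.incident (.inl a))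
    (htF : ∑ e ∈ F, y e = G.existProb F) (htH : ∑ e ∈ H, y e = G.existProb H) :
    ∑ e ∈ F ∪ H, y e = G.existProb (F ∪ H) ∧ ∑ e ∈ F ∩ H, y e = G.existProb (F ∩ H) := by
  have h₁ := hy.2.1 _ (Finset.union_subset hF hH)
  have h₂ := hy.2.1 _ (Finset.inter_subset_left.trans hF : F ∩ H ⊆ _)
  have h₃ := Finset.sum_union_inter (f := y) (s₁ := F) (s₂ := H)
  have h₄ := G.existProb_union_add_inter_le F H
  constructor <;> linarith

/-- A tight set inside the support that is not the whole support can be enlarged by one element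
of the support to a tight set. -/
theorem exists_insert_tight (hy : y ∈ (G.vertexPolytope a).extremePoints ℝ) {F : Finset G.Edge}
    (hF : ∀ e ∈ F, 0 < y e) (ht : ∑ e ∈ F, y e = G.existProb F)
    (hne : ∃ e ∉ F, 0 < y e) :
    ∃ e ∉ F, 0 < y e ∧ ∑ e' ∈ insert e F, y e' = G.existProb (insert e F) := by
  have hinc : ∀ e, 0 < y e → e ∈ G.incident (.inl a) := fun e he => by
    by_contra h
    exact he.ne' (hy.1.1 e h)
  have hFS : F ⊆ G.incident (.inl a) := fun e he => hinc e (hF e he)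
  let 𝓕 : Finset (Finset G.Edge) := Finset.univ.filter fun H =>
    F ⊂ H ∧ (∀ e ∈ H, 0 < y e) ∧ ∑ e ∈ H, y e = G.existProb H
  have h𝓕 : 𝓕.Nonempty := by
    obtain ⟨e, heF, he⟩ := hne
    have hT : ∃ T ⊆ G.incident (.inl a), ∑ e ∈ T, y e = G.existProb T ∧ e ∈ T := by
      by_contra! hcon
      -- If no tight set contained e, the coordinate y e could move freely.
      have := eq_zero_of_mem_extremePoints hy (d := Pi.single e 1) (fun e' he' => by
          rw [Pi.single_apply, if_neg]
          rintro rfl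
          exact he.ne' he')
        (fun T hT hTt => by
          rw [Finset.sum_pi_single', if_neg (hcon T hT hTt)])
      simpa using congrFun this e
    obtain ⟨T, hTS, hTt, heT⟩ := hT
    -- Discarding the zeros of y keeps the sum and does not increase f, so T' is still tight.
    let T' := T.filter fun e => 0 < y e
    have hT'S : T' ⊆ G.incident (.inl a) := (Finset.filter_subset _ _).trans hTS
    have hT't : ∑ e ∈ T', y e = G.existProb T' := by
      refine le_antisymm (hy.1.2.1 _ hT'S) ?_
      calc G.existProb T' ≤ G.existProb T := G.existProb_mono (Finset.filter_subset _ _)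
        _ = ∑ e ∈ T, y e := hTt.symm
        _ = ∑ e ∈ T', y e := by
          refine (Finset.sum_subset (Finset.filter_subset _ _) fun e he he' => ?_).symm
          have h₀ := nonneg_of_mem_vertexPolytope hy.1 e
          simp only [Finset.mem_filter, not_and, not_lt] at he'
          exact le_antisymm (he' he) h₀
    refine ⟨F ∪ T', ?_⟩
    simp only [𝓕, Finset.mem_filter, Finset.mem_univ, true_and]
    refine ⟨Finset.ssubset_iff_subset_ne.2 ⟨Finset.subset_union_left, fun h => heF ?_⟩, ?_,
      (tight_union_inter hy.1 hFS hT'S ht hT't).1⟩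
    · rw [h]
      exact Finset.mem_union_right _ (Finset.mem_filter.2 ⟨heT, he⟩)
    · intro e he
      rcases Finset.mem_union.1 he with he | he
      · exact hF e he
      · exact (Finset.mem_filter.1 he).2
  obtain ⟨H, hH, hmin⟩ := Finset.exists_min_image 𝓕 Finset.card h𝓕
  simp only [𝓕, Finset.mem_filter, Finset.mem_univ, true_and] at hH hmin
  obtain ⟨hFH, hHpos, hHt⟩ := hH
  have hHS : H ⊆ G.incident (.inl a) := fun e he => hinc e (hHpos e he)
  obtain ⟨e, heH, heF⟩ := Finset.exists_of_ssubset hFH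
  -- F ∪ (T ∩ H) is tight by uncrossing and lies in H; containing e₁ ∉ F, it is all of H, because H
  -- has minimal size among the tight proper supersets of F in the support.
  have hsep : ∀ e₁ ∈ H, e₁ ∉ F → ∀ T ⊆ G.incident (.inl a), ∑ e ∈ T, y e = G.existProb T →
      e₁ ∈ T → H ⊆ F ∪ T ∩ H := by
    intro e₁ he₁ he₁F T hT hTt he₁T
    have h₁ := (tight_union_inter hy.1 hT hHS hTt hHt).2
    have h₂ := (tight_union_inter hy.1 hFS (Finset.inter_subset_left.trans hT) ht h₁).1
    have hsub : F ∪ T ∩ H ⊆ H := Finset.union_subset hFH.1 Finset.inter_subset_right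
    refine (Finset.eq_of_subset_of_card_le hsub (hmin _ ⟨?_, fun e he => hHpos e (hsub he), h₂⟩)).ge
    refine Finset.ssubset_iff_subset_ne.2 ⟨Finset.subset_union_left, fun h => he₁F ?_⟩
    rw [h]
    exact Finset.mem_union_right _ (Finset.mem_inter.2 ⟨he₁T, he₁⟩)
  have hsep' : ∀ e₁ ∈ H, e₁ ∉ F → ∀ e₂ ∈ H, e₂ ∉ F → ∀ T ⊆ G.incident (.inl a),
      ∑ e ∈ T, y e = G.existProb T → e₁ ∈ T → e₂ ∈ T := by
    intro e₁ he₁ he₁F e₂ he₂ he₂F T hT hTt he₁T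
    have := hsep e₁ he₁ he₁F T hT hTt he₁T he₂
    simp only [Finset.mem_union, Finset.mem_inter] at this
    tauto
  -- Tight sets do not separate two elements of H \ F, so mass could be shifted from one to the
  -- other.
  have huniq : ∀ e' ∈ H, e' ∉ F → e' = e := by
    intro e' he'H he'F
    by_contra hne
    have := eq_zero_of_mem_extremePoints hy (d := Pi.single e 1 - Pi.single e' 1) (fun e₀ h₀ => by
        have h₁ : e₀ ≠ e := by rintro rfl; exact (hHpos _ heH).ne' h₀
        have h₂ : e₀ ≠ e' := by rintro rfl; exact (hHpos _ he'H).ne' h₀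
        simp [h₁, h₂])
      (fun T hT hTt => by
        have hiff : e ∈ T ↔ e' ∈ T :=
          ⟨hsep' e heH heF e' he'H he'F T hT hTt, hsep' e' he'H he'F e heH heF T hT hTt⟩
        simp only [Pi.sub_apply, Finset.sum_sub_distrib, Finset.sum_pi_single', hiff, sub_self])
    have := congrFun this e
    simp [Ne.symm hne] at this
  have hHe : H = insert e F := by
    ext e'
    rw [Finset.mem_insert]
    refine ⟨fun h => ?_, ?_⟩
    · by_cases h' : e' ∈ F
      · exact .inr h'
      · exact .inl (huniq e' h h')
    · rintro (rfl | h)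
      · exact heH
      · exact hFH.1 h
  exact ⟨e, heF, hHpos e heH, hHe ▸ hHt⟩

/-- The empty set is tight; enlarging it by one support element at a time lists the whole support.
-/
theorem exists_isChainOrder (hy : y ∈ (G.vertexPolytope a).extremePoints ℝ) :
    ∃ σ : G.EdgeOrder a, G.IsChainOrder y σ := by
  let S : Finset G.Edge := Finset.univ.filter fun e => 0 < y e
  have key : ∀ k ≤ S.card, ∃ l : List G.Edge, l.length = k ∧ l.Nodup ∧ (∀ e ∈ l, 0 < y e) ∧
      ∀ i ≤ l.length, ∑ e ∈ (l.take i).toFinset, y e = G.existProb (l.take i).toFinset := by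
    intro k
    induction k with
    | zero => exact fun _ => ⟨[], rfl, List.nodup_nil, by simp, by simp [existProb_empty]⟩
    | succ k ih =>
      intro hk
      obtain ⟨l, hl, hnd, hpos, ht⟩ := ih (by omega)
      have hcard : l.toFinset.card = k := by rw [List.toFinset_card_of_nodup hnd, hl]
      obtain ⟨e, he, hey, hte⟩ := exists_insert_tight hy (F := l.toFinset)
        (fun e he => hpos e (List.mem_toFinset.1 he)) (by simpa using ht l.length le_rfl) (by
          by_contra! hcon
          have : S ⊆ l.toFinset := fun e he => by
            by_contra h
            exact (hcon e h).not_gt (Finset.mem_filter.1 he).2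
          have := Finset.card_le_card this
          omega)
      rw [List.mem_toFinset] at he
      refine ⟨l ++ [e], by simp [hl], ?_, ?_, fun i hi => ?_⟩
      · rw [List.nodup_append]
        refine ⟨hnd, List.nodup_singleton _, fun b hb c hc => ?_⟩
        rw [List.mem_singleton] at hc
        rintro rfl
        exact he (hc ▸ hb)
      · intro e' he'
        rcases List.mem_append.1 he' with h | h
        · exact hpos e' h
        · rw [List.mem_singleton] at h
          exact h ▸ hey
      · rcases Nat.lt_or_ge l.length i with h | h
        · rw [List.take_of_length_le (by simpa using h)]
          have : (l ++ [e]).toFinset = insert e l.toFinset := by ext; simp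
          rw [this, hte]
        · rw [List.take_append_of_le_length h]
          exact ht i h
  obtain ⟨l, hl, hnd, hpos, ht⟩ := key _ le_rfl
  have hS : l.toFinset = S := Finset.eq_of_subset_of_card_le
    (fun e he => Finset.mem_filter.2 ⟨Finset.mem_univ _, hpos e (List.mem_toFinset.1 he)⟩)
    (by rw [List.toFinset_card_of_nodup hnd, hl])
  refine ⟨⟨l, hnd, fun e he => ?_⟩, fun e => ⟨hpos e, fun he => ?_⟩, ht⟩
  · by_contra h
    exact (hpos e he).ne' (hy.1.1 e h)
  · rw [← List.mem_toFinset, hS]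
    exact Finset.mem_filter.2 ⟨Finset.mem_univ _, he⟩

/-! ### Chain orders as selection of the first existing edge -/

/-- The probability that `e₀` is the first edge of a list that exists. -/
def pickProb (G : QCGraph A B) : List G.Edge → G.Edge → ℝ
  | [], _ => 0
  | e :: l, e₀ => if e = e₀ then (G.prob e : ℝ) else (1 - (G.prob e : ℝ)) * G.pickProb l e₀

theorem pickProb_of_notMem {l : List G.Edge} {e : G.Edge} (h : e ∉ l) : G.pickProb l e = 0 := by
  induction l with
  | nil => rfl
  | cons e' l ih =>
    rw [List.mem_cons, not_or] at h
    rw [pickProb, if_neg (Ne.symm h.1), ih h.2, mul_zero]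

/-- The scalar `c` makes the induction work: it plays the role of the probability that all edges
already removed from the front are absent, and becomes `c * (1 - p)` when the head is removed. -/
theorem eq_mul_pickProb_of_tight {l : List G.Edge} (hl : l.Nodup) {c : ℝ}
    (ht : ∀ i ≤ l.length, ∑ e ∈ (l.take i).toFinset, y e = c * G.existProb (l.take i).toFinset)
    {e : G.Edge} (he : e ∈ l) : y e = c * G.pickProb l e := by
  induction l generalizing c with
  | nil => simp at he
  | cons e₀ l ih =>
    rw [List.nodup_cons] at hl
    have h₀ : y e₀ = c * G.prob e₀ := by simpa [existProb] using ht 1 (by simp)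
    rw [pickProb]
    rcases List.mem_cons.1 he with rfl | he
    · rw [if_pos rfl, h₀]
    · rw [if_neg (by rintro rfl; exact hl.1 he), ← mul_assoc]
      refine ih hl.2 (fun i hi => ?_) he
      -- The constraint for the prefix of length i + 1, minus the head's share, is the one for
      -- length i in the tail.
      have h := ht (i + 1) (by simpa using hi)
      have hni : e₀ ∉ (l.take i).toFinset := fun h => hl.1 (List.mem_of_mem_take
        (List.mem_toFinset.1 h))
      rw [List.take_succ_cons, List.toFinset_cons, Finset.sum_insert hni, existProb,
        Finset.prod_insert hni, h₀] at h
      rw [existProb]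
      linarith

theorem IsChainOrder.eq_pickProb {σ : G.EdgeOrder a} (hσ : G.IsChainOrder y σ)
    (hy : y ∈ G.vertexPolytope a) : y = G.pickProb σ.1 := by
  ext e
  by_cases he : e ∈ σ.1
  · simpa using eq_mul_pickProb_of_tight (c := 1) σ.2.1 (by simpa using hσ.2) he
  · rw [pickProb_of_notMem he]
    exact le_antisymm (not_lt.1 fun h => he ((hσ.1 e).2 h)) (nonneg_of_mem_vertexPolytope hy e)

instance (G : QCGraph A B) (a : A) : Finite (G.EdgeOrder a) :=
  Finite.of_injective (β := {l : List G.Edge // l.Nodup}) (fun σ => ⟨σ.1, σ.2.1⟩)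
    fun _ _ h => Subtype.ext (Subtype.mk.inj h)

/-- An extreme point is recovered from its chain order, and there are finitely many orders. -/
theorem finite_extremePoints_vertexPolytope (G : QCGraph A B) (a : A) :
    ((G.vertexPolytope a).extremePoints ℝ).Finite := by
  refine (Set.finite_range fun σ : G.EdgeOrder a => G.pickProb σ.1).subset fun y hy => ?_
  obtain ⟨σ, hσ⟩ := exists_isChainOrder hy
  exact ⟨σ, (hσ.eq_pickProb hy.1).symm⟩

/-- Krein–Milman gives the closed hull; the hull of finitely many points is already closed, so
finite convex combinations suffice. -/
theorem convexHull_extremePoints_vertexPolytope (G : QCGraph A B) (a : A) :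
    convexHull ℝ ((G.vertexPolytope a).extremePoints ℝ) = G.vertexPolytope a := by
  rw [← ((G.finite_extremePoints_vertexPolytope a).isClosed_convexHull ℝ).closure_eq]
  exact closure_convexHull_extremePoints (G.isCompact_vertexPolytope a)
    (G.convex_vertexPolytope a)

theorem exists_isPermDist {x : G.Edge → ℝ} (hx : x ∈ G.lpFeasible) (a : A) :
    ∃ D : PMF (G.EdgeOrder a), G.IsPermDist x a D := by
  have hmem : (fun e => if e ∈ G.incident (.inl a) then x e else 0) ∈ G.vertexPolytope a := by
    refine ⟨fun e he => if_neg he, fun F hF => ?_, fun e he => ?_⟩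
    · rw [Finset.sum_congr rfl fun e he => if_pos (hF he)]
      exact hx.1 _ F hF
    · simpa only [if_pos he] using hx.2 e
  rw [← convexHull_extremePoints_vertexPolytope, mem_convexHull_iff_exists_fintype] at hmem
  obtain ⟨ι, _, w, z, hw, hw1, hz, hsum⟩ := hmem
  let f := (Fintype.equivFin ι).symm
  choose σ hσ using fun i => exists_isChainOrder (hz (f i))
  have hone : ∑ i, ENNReal.ofReal (w (f i)) = 1 := by
    rw [← ENNReal.ofReal_sum_of_nonneg fun i _ => hw _, Equiv.sum_comp f w, hw1, ENNReal.ofReal_one]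
  refine ⟨_, Fintype.card ι, PMF.ofFintype (fun i => ENNReal.ofReal (w (f i))) hone,
    fun i => z (f i), σ, fun i => hz _, fun e he => ?_, hσ, rfl⟩
  have h := congrFun hsum e
  rw [if_pos he, Finset.sum_apply] at h
  rw [← h, ← Equiv.sum_comp f]
  simp [ENNReal.toReal_ofReal (hw _)]

/-- Under the distribution of the orders of `E_a`, the edge `e` is picked with probability `x_e`. -/
theorem IsPermDist.integral_pickProb {x : G.Edge → ℝ} {D : PMF (G.EdgeOrder a)}
    (hD : G.IsPermDist x a D) {e : G.Edge} (he : e ∈ G.incident (.inl a)) :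
    ∫ σ, G.pickProb σ.1 e ∂D.toMeasure = x e := by
  obtain ⟨k, c, y, σ, hy, hx, hσ, rfl⟩ := hD
  rw [← PMF.toMeasure_map _ _ (measurable_of_countable _), integral_map
    (measurable_of_countable _).aemeasurable
    (Measurable.aestronglyMeasurable fun _ _ => MeasurableSpace.measurableSet_top),
    PMF.integral_eq_sum, hx e he]
  refine Finset.sum_congr rfl fun i _ => ?_
  rw [smul_eq_mul, ← (hσ i).eq_pickProb (hy i).1]

end QCGraph

/-! ### Approx-QC as a strategy: commit rule, locality and measurability -/

namespace QCGraph

variable {A B : Type*} [DecidableEq A] [DecidableEq B] (G : QCGraph A B) (x : G.Edge → ℝ)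

/-- The price of the right end point of `e` at time `t` is at most the weight of `e`. -/
def MeetsPrice (t : ℝ) (e : G.Edge) : Prop :=
  (1 - Real.exp (t - 1)) * G.basePrice x (right e) ≤ G.weight e

theorem processVertex_commits {coin : G.Edge → Bool} {t : ℝ} {M : Finset G.Edge}
    {next : Finset G.Edge → QueryTree G.Edge} {l : List G.Edge} {a : A}
    (hl : ∀ e ∈ l, left e = a) (hM : ∀ e ∈ M, left e ≠ a) (hnext : G.Commits M (next M))
    (hnext' : ∀ e ∈ l, G.Commits (insert e M) (next (insert e M))) :
    G.Commits M (G.processVertex x coin t M next l) := by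
  induction l with
  | nil => exact hnext
  | cons e l ih =>
    have ih := ih (fun e he => hl e (List.mem_cons_of_mem _ he))
      fun e he => hnext' e (List.mem_cons_of_mem _ he)
    rw [processVertex]
    split_ifs with h hc
    · refine ⟨fun e' he' => ⟨?_, h.2 e' he'⟩, hnext' e List.mem_cons_self, ih⟩
      rw [hl e List.mem_cons_self]
      exact hM e' he'
    · exact hnext
    · exact ih

theorem EdgeOrder.left_eq {G : QCGraph A B} {a : A} (σ : G.EdgeOrder a) {e : G.Edge}
    (he : e ∈ σ.1) : left e = a := by
  simpa [incident] using σ.2.2 e he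

theorem processAll_commits {coin : G.Edge → Bool} {t : A → unitInterval}
    {σ : ∀ a, G.EdgeOrder a} {L : List A} (hL : L.Nodup) {M : Finset G.Edge}
    (hM : ∀ e ∈ M, left e ∉ L) : G.Commits M (G.processAll x coin t σ L M) := by
  induction L generalizing M with
  | nil => simp [processAll, Commits]
  | cons a L ih =>
    rw [List.nodup_cons] at hL
    refine G.processVertex_commits x (a := a) (fun e he => (σ a).left_eq he)
      (fun e he h => hM e he (h ▸ List.mem_cons_self))
      (ih hL.2 fun e he h => hM e he (List.mem_cons_of_mem _ h)) fun e he => ih hL.2 ?_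
    intro e' he'
    rcases Finset.mem_insert.1 he' with rfl | he'
    · rw [(σ a).left_eq he]
      exact hL.1
    · exact fun h => hM e' he' (List.mem_cons_of_mem _ h)

theorem processVertex_output_congr {coin coin' ω ω' : G.Edge → Bool} {t : ℝ} {M : Finset G.Edge}
    {next next' : Finset G.Edge → QueryTree G.Edge} {l : List G.Edge}
    (hnext : ∀ M, (next M).output ω = (next' M).output ω')
    (hl : ∀ e ∈ l, coin e = coin' e ∧ ω e = ω' e) :
    (G.processVertex x coin t M next l).output ω =
      (G.processVertex x coin' t M next' l).output ω' := by
  induction l with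
  | nil => exact hnext M
  | cons e l ih =>
    have ih := ih fun e he => hl e (List.mem_cons_of_mem _ he)
    obtain ⟨h₁, h₂⟩ := hl e List.mem_cons_self
    rw [processVertex, processVertex, h₁]
    split_ifs with h hc
    · rw [QueryTree.output, QueryTree.output, hnext, ih, h₂]
    · exact hnext M
    · exact ih

/-- Locality: only the orders and bits of vertices still to be processed matter. This is what later
makes the randomness at one vertex independent of the continuation. -/
theorem processAll_output_congr {coin coin' ω ω' : G.Edge → Bool} {t : A → unitInterval}
    {σ σ' : ∀ a, G.EdgeOrder a} {L : List A} (hσ : ∀ a ∈ L, σ a = σ' a)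
    (hL : ∀ e : G.Edge, left e ∈ L → coin e = coin' e ∧ ω e = ω' e) (M : Finset G.Edge) :
    (G.processAll x coin t σ L M).output ω = (G.processAll x coin' t σ' L M).output ω' := by
  induction L generalizing M with
  | nil => rfl
  | cons a L ih =>
    rw [processAll, processAll, hσ a List.mem_cons_self]
    refine G.processVertex_output_congr x (fun M => ih (fun a ha => hσ a (List.mem_cons_of_mem _ ha))
      (fun e he => hL e (List.mem_cons_of_mem _ he)) M) fun e he => hL e ?_
    rw [(σ' a).left_eq he]
    exact List.mem_cons_self

theorem processVertex_congr_time {coin : G.Edge → Bool} {t t' : ℝ} {M : Finset G.Edge}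
    {next : Finset G.Edge → QueryTree G.Edge} {l : List G.Edge}
    (h : ∀ e, G.MeetsPrice x t e ↔ G.MeetsPrice x t' e) :
    G.processVertex x coin t M next l = G.processVertex x coin t' M next l := by
  induction l with
  | nil => rfl
  | cons e l ih =>
    have h := h e
    simp only [MeetsPrice] at h
    simp only [processVertex, h, ih]

theorem processAll_congr_time {coin : G.Edge → Bool} {t t' : A → unitInterval}
    {σ : ∀ a, G.EdgeOrder a} (h : ∀ a e, G.MeetsPrice x (t a) e ↔ G.MeetsPrice x (t' a) e)
    (L : List A) : G.processAll x coin t σ L = G.processAll x coin t' σ L := by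
  induction L with
  | nil => funext M; rfl
  | cons a L ih =>
    funext M
    rw [processAll, processAll, ih, G.processVertex_congr_time x (h a)]

theorem measurableSet_meetsPrice (e : G.Edge) : MeasurableSet {t : ℝ | G.MeetsPrice x t e} :=
  measurableSet_le (by fun_prop) measurable_const

theorem _root_.Measurable.of_factors {X K Y : Type*} [MeasurableSpace X] [MeasurableSpace K]
    [DiscreteMeasurableSpace K] [MeasurableSpace Y] [Nonempty Y] {k : X → K} (hk : Measurable k)
    {f : X → Y} (h : ∀ r r', k r = k r' → f r = f r') : Measurable f := by
  have hf : Function.FactorsThrough f k := fun r r' hr => h r r' hr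
  obtain ⟨g, hg⟩ := (Function.factorsThrough_iff f).1 hf
  rw [hg]
  exact (Measurable.of_discrete).comp hk

instance (a : A) : DiscreteMeasurableSpace (G.EdgeOrder a) :=
  ⟨fun _ => MeasurableSpace.measurableSet_top⟩

variable [Fintype A]

open Classical in
-- Strategies carry the discrete sigma-algebra, so measurability in the continuous arrival times
-- needs an argument: the times matter only through finitely many comparisons, with each other and
-- with prices, and these form a measurable map to a discrete space.
theorem measurable_approxQCStrategy : Measurable (G.approxQCStrategy x) := by
  have : Nonempty (QueryTree G.Edge) := ⟨.halt⟩
  refine Measurable.of_factors (K := ((A → A → Bool) × (A → G.Edge → Bool)) ×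
      (∀ a, G.EdgeOrder a) × (G.Edge → Bool))
    (k := fun r => ((fun a a' => decide (r.1 a ≤ r.1 a'),
      fun a e => decide (G.MeetsPrice x (r.1 a) e)), r.2)) ?_ ?_
  · refine (Measurable.prodMk ?_ ?_).prodMk measurable_snd
    · refine measurable_pi_lambda _ fun a => measurable_pi_lambda _ fun a' => ?_
      refine measurable_to_bool ?_
      have : (fun r : (A → unitInterval) × (∀ a, G.EdgeOrder a) × (G.Edge → Bool) =>
          decide (r.1 a ≤ r.1 a')) ⁻¹' {true} = {r | r.1 a ≤ r.1 a'} := by ext; simp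
      rw [this]
      exact measurableSet_le (by fun_prop) (by fun_prop)
    · refine measurable_pi_lambda _ fun a => measurable_pi_lambda _ fun e => ?_
      refine measurable_to_bool ?_
      have : (fun r : (A → unitInterval) × (∀ a, G.EdgeOrder a) × (G.Edge → Bool) =>
          decide (G.MeetsPrice x (r.1 a) e)) ⁻¹' {true} =
          (fun r => (r.1 a : ℝ)) ⁻¹' {t | G.MeetsPrice x t e} := by ext; simp
      rw [this]
      exact (by fun_prop : Measurable fun r : (A → unitInterval) × (∀ a, G.EdgeOrder a) ×
        (G.Edge → Bool) => (r.1 a : ℝ)) (G.measurableSet_meetsPrice x e)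
  · rintro ⟨t, r⟩ ⟨t', r'⟩ h
    simp only [Prod.mk.injEq, funext_iff, decide_eq_decide] at h
    obtain ⟨⟨h₁, h₂⟩, h₃⟩ := h
    obtain rfl : r = r' := h₃
    simp only [approxQCStrategy, h₁]
    rw [G.processAll_congr_time x h₂]

theorem isQueryCommit_approxQC (D : ∀ a, PMF (G.EdgeOrder a)) :
    G.IsQueryCommit (G.approxQC x D) := by
  refine ⟨Measure.isProbabilityMeasure_map (G.measurable_approxQCStrategy x).aemeasurable, ?_⟩
  rw [approxQC, ae_map_iff (G.measurable_approxQCStrategy x).aemeasurable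
    MeasurableSpace.measurableSet_top]
  refine ae_of_all _ fun r => G.processAll_commits x ?_ (by simp)
  exact (List.mergeSort_perm _ _).nodup_iff.2 (Finset.nodup_toList _)

end QCGraph

/-! ### One item at a decreasing price: the estimate in continuous time -/

namespace DecreasingPrice

variable {ι : Type*}

/-- The rate at which a buyer arriving with probability `x` at a uniform time and having value `w`
buys an item of base price `c` at time `s`. -/
noncomputable def rate (c x w s : ℝ) : ℝ := if (1 - Real.exp (s - 1)) * c ≤ w then x else 0

theorem rate_mem {c x w : ℝ} (hx : 0 ≤ x) (s : ℝ) : 0 ≤ rate c x w s ∧ rate c x w s ≤ x := by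
  rw [rate]
  split_ifs
  exacts [⟨hx, le_rfl⟩, ⟨le_rfl, hx⟩]

theorem monotone_rate {c x w : ℝ} (hc : 0 ≤ c) (hx : 0 ≤ x) : Monotone (rate c x w) := by
  intro s t hst
  by_cases h : (1 - Real.exp (s - 1)) * c ≤ w
  · have h' : (1 - Real.exp (t - 1)) * c ≤ w := by
      refine le_trans (mul_le_mul_of_nonneg_right ?_ hc) h
      have := Real.exp_le_exp.2 (sub_le_sub_right hst 1)
      linarith
    rw [rate, rate, if_pos h, if_pos h']
  · rw [rate, if_neg h]
    exact (rate_mem hx t).1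

/-- The rate jumps when the price reaches `w`. The price test is non-strict and stays satisfied once
met, so the jump is right-continuous and primitives have right derivatives everywhere. -/
theorem continuousWithinAt_rate {c x w : ℝ} (hc : 0 ≤ c) (hx : 0 ≤ x) (s : ℝ) :
    ContinuousWithinAt (rate c x w) (Set.Ioi s) s := by
  by_cases h : (1 - Real.exp (s - 1)) * c ≤ w
  · refine (continuousWithinAt_const (b := x)).congr (fun t ht => ?_) (if_pos h)
    refine le_antisymm (rate_mem hx t).2 ?_
    calc x = rate c x w s := (if_pos h).symm
      _ ≤ rate c x w t := monotone_rate hc hx (le_of_lt ht)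
  · have hcont : ContinuousAt (fun s : ℝ => (1 - Real.exp (s - 1)) * c) s := by fun_prop
    refine ContinuousAt.continuousWithinAt ?_
    refine (continuousAt_const (y := (0 : ℝ))).congr ?_
    filter_upwards [hcont.eventually_const_lt (not_le.1 h)] with t ht
    exact (if_neg (not_le.2 ht)).symm

theorem measurable_rate (c x w : ℝ) : Measurable (rate c x w) :=
  Measurable.ite (measurableSet_le (by fun_prop) measurable_const) measurable_const
    measurable_const

theorem intervalIntegrable_rate {c x w : ℝ} (hc : 0 ≤ c) (hx : 0 ≤ x) (a b : ℝ) :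
    IntervalIntegrable (rate c x w) volume a b :=
  (monotone_rate hc hx).intervalIntegrable

theorem integral_rate_mem {c x w : ℝ} (hc : 0 ≤ c) (hx : 0 ≤ x) {s : ℝ} (hs : 0 ≤ s)
    (hs' : s ≤ 1) :
    0 ≤ ∫ u in (0 : ℝ)..s, rate c x w u ∧ ∫ u in (0 : ℝ)..s, rate c x w u ≤ x := by
  refine ⟨intervalIntegral.integral_nonneg hs fun u _ => (rate_mem hx u).1, ?_⟩
  calc ∫ u in (0 : ℝ)..s, rate c x w u ≤ ∫ _ in (0 : ℝ)..s, x :=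
        intervalIntegral.integral_mono_on hs (intervalIntegrable_rate hc hx _ _) (by simp)
          fun u _ => (rate_mem hx u).2
    _ = s * x := by simp
    _ ≤ x := mul_le_of_le_one_left hx hs'

variable [Fintype ι] [DecidableEq ι] {x w : ι → ℝ} {c : ℝ}

/-- A seller whose price decreases from `(1 - 1/e) c` to `0` gets at least `(1 - 1/e) c`. -/
theorem le_sum_integral_rate (hx : ∀ i, 0 ≤ x i) (hxw : ∀ i, 0 ≤ x i * w i)
    (hsum : ∑ i, x i ≤ 1) (hc : c = ∑ i, x i * w i) :
    (1 - 1 / Real.exp 1) * c ≤ ∑ i, ∫ s in (0 : ℝ)..1, rate c (x i) (w i) s * w i *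
      ∏ j ∈ Finset.univ.erase i, (1 - ∫ u in (0 : ℝ)..s, rate c (x j) (w j) u) := by
  have hc0 : 0 ≤ c := hc ▸ Finset.sum_nonneg fun i _ => hxw i
  have hx1 : ∀ i, x i ≤ 1 := fun i =>
    (Finset.single_le_sum (fun j _ => hx j) (Finset.mem_univ i)).trans hsum
  set q : ι → ℝ → ℝ := fun i => rate c (x i) (w i) with hq
  set H : ι → ℝ → ℝ := fun i s => ∫ u in (0 : ℝ)..s, q i u with hH
  set R : ι → ℝ → ℝ := fun i s => ∏ j ∈ Finset.univ.erase i, (1 - H j s) with hR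
  set r : ℝ → ℝ := fun s => ∏ j, (1 - H j s) with hr
  have hHcont : ∀ i, Continuous (H i) := fun i =>
    intervalIntegral.continuous_primitive (fun a b => intervalIntegrable_rate hc0 (hx i) a b) 0
  have hRcont : ∀ i, Continuous (R i) := fun i => by fun_prop
  have hrcont : Continuous r := by fun_prop
  have hHderiv : ∀ i s, HasDerivWithinAt (H i) (q i s) (Set.Ioi s) s := fun i s =>
    (intervalIntegral.integral_hasDerivWithinAt_right (s := Set.Ici s) (t := Set.Ioi s)
      (intervalIntegrable_rate hc0 (hx i) _ _)
      (measurable_rate _ _ _).stronglyMeasurable.stronglyMeasurableAtFilter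
      (continuousWithinAt_rate hc0 (hx i) s)).mono Set.Ioi_subset_Ici_self
  have hrderiv : ∀ s, HasDerivWithinAt r (∑ i, R i s * -q i s) (Set.Ioi s) s := fun s => by
    have := HasDerivWithinAt.fun_finsetProd (u := Finset.univ) (f := fun i s => 1 - H i s)
      (f' := fun i => -q i s) (s := Set.Ioi s) (x := s) fun i _ => (hHderiv i s).const_sub 1
    simpa only [smul_eq_mul] using this
  -- The potential: price times probability of being unsold. It falls from (1 - 1/e) c to 0.
  set Φ : ℝ → ℝ := fun s => (1 - Real.exp (s - 1)) * c * r s with hΦ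
  set Φ' : ℝ → ℝ := fun s => -(Real.exp (s - 1)) * c * r s +
    (1 - Real.exp (s - 1)) * c * ∑ i, R i s * -q i s with hΦ'
  have hΦderiv : ∀ s, HasDerivWithinAt Φ (Φ' s) (Set.Ioi s) s := fun s => by
    have h₁ : HasDerivAt (fun s : ℝ => (1 - Real.exp (s - 1)) * c) (-(Real.exp (s - 1)) * c) s := by
      have := (((hasDerivAt_id s).sub_const 1).exp.const_sub 1).mul_const c
      simpa using this
    exact h₁.hasDerivWithinAt.mul (hrderiv s)
  have hqRint : ∀ i, IntervalIntegrable (fun s => R i s * -q i s) volume 0 1 := fun i =>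
    (intervalIntegrable_rate hc0 (hx i) 0 1).neg.continuousOn_mul (hRcont i).continuousOn
  have hqwRint : ∀ i, IntervalIntegrable (fun s => q i s * w i * R i s) volume 0 1 := fun i =>
    ((intervalIntegrable_rate hc0 (hx i) 0 1).mul_const _).mul_continuousOn (hRcont i).continuousOn
  have hΦint : IntervalIntegrable Φ' volume 0 1 := by
    refine IntervalIntegrable.add (Continuous.intervalIntegrable (by fun_prop) _ _) ?_
    refine IntervalIntegrable.continuousOn_mul ?_ (Continuous.continuousOn (by fun_prop))
    simpa only [Finset.sum_fn] using IntervalIntegrable.sum Finset.univ fun i _ => hqRint i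
  have hFTC : ∫ s in (0 : ℝ)..1, Φ' s = Φ 1 - Φ 0 :=
    intervalIntegral.integral_eq_sub_of_hasDeriv_right_of_le zero_le_one
      (Continuous.continuousOn (by fun_prop)) (fun s _ => hΦderiv s) hΦint
  have hΦ1 : Φ 1 = 0 := by simp [hΦ]
  have hΦ0 : Φ 0 = (1 - 1 / Real.exp 1) * c := by simp [hΦ, hr, hH, Real.exp_neg]
  have hpoint : ∀ s ∈ Set.Icc (0 : ℝ) 1, -Φ' s ≤ ∑ i, q i s * w i * R i s := by
    rintro s ⟨hs, hs'⟩
    have hH1 : ∀ j, 0 ≤ 1 - H j s ∧ 1 - H j s ≤ 1 := fun j => by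
      have := integral_rate_mem (w := w j) hc0 (hx j) hs hs'
      have := hx1 j
      simp only [hH, hq]
      constructor <;> linarith
    have hr0 : 0 ≤ r s := Finset.prod_nonneg fun j _ => (hH1 j).1
    have hrR : ∀ i, r s ≤ R i s := fun i => by
      simp only [hr, hR]
      rw [← Finset.mul_prod_erase Finset.univ _ (Finset.mem_univ i)]
      exact mul_le_of_le_one_left (Finset.prod_nonneg fun j _ => (hH1 j).1) (hH1 i).2
    have hexp : 0 ≤ 1 - Real.exp (s - 1) := by
      have := Real.exp_le_one_iff.2 (sub_nonpos.2 hs')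
      linarith
    set p : ℝ := (1 - Real.exp (s - 1)) * c with hp
    have hp0 : 0 ≤ p := mul_nonneg hexp hc0
    -- A buyer who meets the price has nonnegative surplus, and r ≤ R i; for one who does not, the
    -- left side is nonpositive and the right side vanishes.
    have hterm : ∀ i, x i * (w i - p) * r s ≤ q i s * (w i - p) * R i s := by
      intro i
      simp only [hq, rate]
      split_ifs with h
      · exact mul_le_mul_of_nonneg_left (hrR i) (mul_nonneg (hx i) (sub_nonneg.2 h))
      · rw [zero_mul, zero_mul]
        exact mul_nonpos_of_nonpos_of_nonneg
          (mul_nonpos_of_nonneg_of_nonpos (hx i) (sub_nonpos.2 (not_le.1 h).le)) hr0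
    have h₁ := Finset.sum_le_sum fun i (_ : i ∈ Finset.univ) => hterm i
    have h₂ : ∑ i, x i * (w i - p) * r s = (c - (∑ i, x i) * p) * r s := by
      rw [hc, Finset.sum_mul, ← Finset.sum_sub_distrib, Finset.sum_mul]
      exact Finset.sum_congr rfl fun i _ => by ring
    have h₃ : ∑ i, q i s * (w i - p) * R i s =
        ∑ i, q i s * w i * R i s + p * ∑ i, R i s * -q i s := by
      rw [Finset.mul_sum, ← Finset.sum_add_distrib]
      exact Finset.sum_congr rfl fun i _ => by ring
    -- This is the only place where total demand at most 1 enters the surplus estimate.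
    have h₄ : (c - p) * r s ≤ (c - (∑ i, x i) * p) * r s :=
      mul_le_mul_of_nonneg_right (sub_le_sub_left (mul_le_of_le_one_left hp0 hsum) _) hr0
    -- The price satisfies p' = p - c, so this cancels the derivative of the price in Φ'.
    have h₅ : (c - p) * r s = Real.exp (s - 1) * c * r s := by rw [hp]; ring
    simp only [hΦ']
    linarith
  calc (1 - 1 / Real.exp 1) * c = ∫ s in (0 : ℝ)..1, -Φ' s := by
        rw [intervalIntegral.integral_neg, hFTC, hΦ1, hΦ0]; ring
    _ ≤ ∫ s in (0 : ℝ)..1, ∑ i, q i s * w i * R i s := by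
        refine intervalIntegral.integral_mono_on zero_le_one hΦint.neg ?_ hpoint
        simpa only [Finset.sum_fn] using IntervalIntegrable.sum Finset.univ fun i _ => hqwRint i
    _ = _ := intervalIntegral.integral_finsetSum fun i _ => hqwRint i

end DecreasingPrice

/-! ### Resampling a coordinate of a product measure -/

section Resampling

variable {ι : Type*} [Fintype ι] [DecidableEq ι] {α : ι → Type*} [∀ i, MeasurableSpace (α i)]
  (μ : ∀ i, Measure (α i)) [∀ i, IsProbabilityMeasure (μ i)]

theorem measurePreserving_update (i : ι) :
    MeasurePreserving (fun p : α i × (∀ j, α j) => Function.update p.2 i p.1)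
      ((μ i).prod (Measure.pi μ)) (Measure.pi μ) := by
  have hm : Measurable fun p : α i × (∀ j, α j) => Function.update p.2 i p.1 := by
    refine measurable_pi_iff.2 fun j => ?_
    by_cases h : j = i
    · subst h
      simpa using measurable_fst
    · simp only [Function.update_of_ne h]
      fun_prop
  refine ⟨hm, (Measure.pi_eq fun s hs => ?_).symm⟩
  have hpre : (fun p : α i × (∀ j, α j) => Function.update p.2 i p.1) ⁻¹' Set.pi Set.univ s =
      s i ×ˢ Set.pi Set.univ (Function.update s i Set.univ) := by
    ext p
    simp only [Set.mem_preimage, Set.mem_pi, Set.mem_univ, true_imp_iff, Set.mem_prod]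
    constructor
    · refine fun h => ⟨by simpa using h i, fun j => ?_⟩
      by_cases hj : j = i
      · subst hj; simp
      · simpa [hj] using h j
    · refine fun h j => ?_
      by_cases hj : j = i
      · subst hj; simpa using h.1
      · simpa [hj] using h.2 j
  rw [Measure.map_apply hm (MeasurableSet.univ_pi hs), hpre, Measure.prod_prod, Measure.pi_pi,
    ← Finset.mul_prod_erase _ (fun j => μ j (s j)) (Finset.mem_univ i),
    ← Finset.mul_prod_erase _ _ (Finset.mem_univ i)]
  simp only [Function.update_self, measure_univ, one_mul]
  congr 1
  exact Finset.prod_congr rfl fun j hj => by rw [Function.update_of_ne (Finset.ne_of_mem_erase hj)]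

/-- Resampling one coordinate of a product measure. -/
theorem integral_pi_update {f : (∀ j, α j) → ℝ} (hf : Integrable f (Measure.pi μ)) (i : ι) :
    ∫ y, f y ∂Measure.pi μ = ∫ s, ∫ y, f (Function.update y i s) ∂Measure.pi μ ∂μ i := by
  have hp := measurePreserving_update μ i
  rw [← integral_prod (fun p : α i × (∀ j, α j) => f (Function.update p.2 i p.1))
    ((hp.integrable_comp hf.aestronglyMeasurable).2 hf)]
  conv_lhs => rw [← hp.map_eq]
  exact integral_map hp.measurable.aemeasurable (by rw [hp.map_eq]; exact hf.aestronglyMeasurable)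

end Resampling

/-! ### The sale at random arrival times -/

namespace DecreasingPrice

variable {ι : Type*}

/-- The expected value sold by offering an item to the given list of buyers, where `i` buys an
unsold item with probability `q i` and has value `w i`. -/
def saleValue (q w : ι → ℝ) : List ι → ℝ
  | [] => 0
  | i :: L => saleValue q w L + q i * (w i - saleValue q w L)

variable [DecidableEq ι]

/-- Buyer i gets the item if nobody earlier bought it. The product also charges i for later buyers
with the same arrival time; since `q i * w i` is nonnegative, such ties only lower the bound, which
therefore holds for every tie-breaking. -/
theorem le_saleValue {q w : ι → ℝ} (hq : ∀ i, 0 ≤ q i ∧ q i ≤ 1) (hqw : ∀ i, 0 ≤ q i * w i)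
    {t : ι → unitInterval} {L : List ι} (hL : L.Nodup) (ht : L.Pairwise fun i j => t i ≤ t j) :
    ∑ i ∈ L.toFinset, q i * w i *
      ∏ j ∈ L.toFinset.erase i, (1 - if t j ≤ t i then q j else 0) ≤ saleValue q w L := by
  have hfac : ∀ i j, 0 ≤ 1 - (if t j ≤ t i then q j else 0) ∧
      1 - (if t j ≤ t i then q j else 0) ≤ 1 := fun i j => by
    have := hq j
    split_ifs <;> constructor <;> linarith
  induction L with
  | nil => simp [saleValue]
  | cons a L ih =>
    rw [List.nodup_cons] at hL
    rw [List.pairwise_cons] at ht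
    have ih := ih hL.2 ht.2
    have ha : a ∉ L.toFinset := by simpa using hL.1
    rw [List.toFinset_cons, Finset.sum_insert ha, saleValue]
    have h₁ : q a * w a * ∏ j ∈ (insert a L.toFinset).erase a, (1 - if t j ≤ t a then q j else 0) ≤
        q a * w a :=
      mul_le_of_le_one_right (hqw a) (Finset.prod_le_one (fun j _ => (hfac a j).1)
        fun j _ => (hfac a j).2)
    have h₂ : ∑ i ∈ L.toFinset, q i * w i *
          ∏ j ∈ (insert a L.toFinset).erase i, (1 - if t j ≤ t i then q j else 0) =
        (1 - q a) * ∑ i ∈ L.toFinset, q i * w i *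
          ∏ j ∈ L.toFinset.erase i, (1 - if t j ≤ t i then q j else 0) := by
      rw [Finset.mul_sum]
      refine Finset.sum_congr rfl fun i hi => ?_
      have hne : i ≠ a := by rintro rfl; exact ha hi
      rw [Finset.erase_insert_of_ne hne.symm,
        Finset.prod_insert (fun h => ha (Finset.mem_of_mem_erase h)),
        if_pos (ht.1 i (List.mem_toFinset.1 hi))]
      ring
    have h₃ := mul_le_mul_of_nonneg_left ih (sub_nonneg.2 (hq a).2)
    rw [h₂]
    linarith

variable [Fintype ι] {x w : ι → ℝ} {c : ℝ}

/-- A lower bound for the value of a sale to buyers with arrival times `t`. -/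
noncomputable def saleBound (c : ℝ) (x w : ι → ℝ) (t : ι → unitInterval) (i : ι) : ℝ :=
  rate c (x i) (w i) (t i) * w i *
    ∏ j ∈ Finset.univ.erase i, (1 - if t j ≤ t i then rate c (x j) (w j) (t j) else 0)

theorem integrable_saleBound (hx : ∀ i, 0 ≤ x i ∧ x i ≤ 1) (i : ι) :
    Integrable (fun t => saleBound c x w t i) (Measure.pi fun _ : ι => volume) := by
  refine Integrable.of_bound (C := |w i|) (Measurable.aestronglyMeasurable ?_)
    (ae_of_all _ fun t => ?_)
  · have hrate : ∀ j, Measurable fun t : ι → unitInterval => rate c (x j) (w j) (t j) := fun j =>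
      (measurable_rate _ _ _).comp (by fun_prop)
    refine ((hrate i).mul_const _).mul (Finset.measurable_prod _ fun j _ => ?_)
    exact measurable_const.sub (Measurable.ite (measurableSet_le (by fun_prop) (by fun_prop))
      (hrate j) measurable_const)
  · have hr : ∀ j, 0 ≤ rate c (x j) (w j) (t j) ∧ rate c (x j) (w j) (t j) ≤ 1 := fun j =>
      ⟨(rate_mem (hx j).1 _).1, (rate_mem (hx j).1 _).2.trans (hx j).2⟩
    have hfac : ∀ j, 0 ≤ 1 - (if t j ≤ t i then rate c (x j) (w j) (t j) else 0) ∧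
        1 - (if t j ≤ t i then rate c (x j) (w j) (t j) else 0) ≤ 1 := fun j => by
      have := hr j
      split_ifs <;> constructor <;> linarith
    have hP := Finset.prod_nonneg (s := Finset.univ.erase i) fun j _ => (hfac j).1
    have hP' := Finset.prod_le_one (s := Finset.univ.erase i) (fun j _ => (hfac j).1)
      fun j _ => (hfac j).2
    rw [saleBound, Real.norm_eq_abs, abs_mul, abs_mul, abs_of_nonneg (hr i).1, abs_of_nonneg hP]
    calc _ ≤ 1 * |w i| * 1 := by gcongr; exact (hr i).2
      _ = |w i| := by ring

theorem integral_unitInterval_ite_le {f : ℝ → ℝ} (s : unitInterval) :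
    ∫ u : unitInterval, (if u ≤ s then f u else 0) = ∫ u in (0 : ℝ)..s, f u := by
  have h := integral_subtype (measurableSet_Icc (a := (0 : ℝ)) (b := 1))
    fun u => (Set.Iic (s : ℝ)).indicator f u
  have h' : ∀ u : unitInterval, (if u ≤ s then f u else 0) = (Set.Iic (s : ℝ)).indicator f u :=
    fun u => by simp [Set.indicator_apply]
  simp_rw [h']
  refine h.trans ?_
  rw [setIntegral_indicator measurableSet_Iic, intervalIntegral.integral_of_le s.2.1,
    ← integral_Icc_eq_integral_Ioc]
  congr 2
  ext u
  simp only [Set.mem_inter_iff, Set.mem_Icc, Set.mem_Iic]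
  exact ⟨fun h => ⟨h.1.1, h.2⟩, fun h => ⟨⟨h.1, h.2.trans s.2.2⟩, h.2⟩⟩

/-- Once the arrival time of i is fixed at s, the remaining factors depend on distinct independent
times, so the integral of the product factors. -/
theorem integral_saleBound (hx : ∀ i, 0 ≤ x i ∧ x i ≤ 1) (i : ι) :
    ∫ t, saleBound c x w t i ∂(Measure.pi fun _ : ι => volume) =
      ∫ s in (0 : ℝ)..1, rate c (x i) (w i) s * w i *
        ∏ j ∈ Finset.univ.erase i, (1 - ∫ u in (0 : ℝ)..s, rate c (x j) (w j) u) := by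
  rw [integral_pi_update _ (integrable_saleBound hx i) i]
  have hinner : ∀ s : unitInterval,
      ∫ t, saleBound c x w (Function.update t i s) i ∂(Measure.pi fun _ : ι => volume) =
      rate c (x i) (w i) s * w i *
        ∏ j ∈ Finset.univ.erase i, (1 - ∫ u in (0 : ℝ)..s, rate c (x j) (w j) u) := by
    intro s
    -- A dummy factor 1 at i turns the product into one over all coordinates, as Fubini for products
    -- requires.
    have hrw : ∀ t : ι → unitInterval, saleBound c x w (Function.update t i s) i =
        rate c (x i) (w i) s * w i * ∏ j, if j = i then 1 else
          (1 - if t j ≤ s then rate c (x j) (w j) (t j) else 0) := by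
      intro t
      rw [saleBound, Function.update_self, ← Finset.mul_prod_erase Finset.univ _ (Finset.mem_univ i),
        if_pos rfl, one_mul]
      congr 1
      refine Finset.prod_congr rfl fun j hj => ?_
      rw [Function.update_of_ne (Finset.ne_of_mem_erase hj), if_neg (Finset.ne_of_mem_erase hj)]
    simp_rw [hrw]
    rw [integral_const_mul, integral_fintype_prod_eq_prod (fun j (u : unitInterval) =>
      if j = i then (1 : ℝ) else (1 - if u ≤ s then rate c (x j) (w j) u else 0)),
      ← Finset.mul_prod_erase Finset.univ _ (Finset.mem_univ i)]
    simp only [if_true, integral_const, probReal_univ, smul_eq_mul, one_mul]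
    congr 1
    refine Finset.prod_congr rfl fun j hj => ?_
    simp only [if_neg (Finset.ne_of_mem_erase hj)]
    rw [integral_sub (integrable_const _), integral_unitInterval_ite_le]
    · simp
    · refine Integrable.of_bound (C := x j) (Measurable.aestronglyMeasurable ?_)
        (ae_of_all _ fun u => ?_)
      · exact Measurable.ite (measurableSet_le measurable_id measurable_const)
          ((measurable_rate _ _ _).comp measurable_subtype_coe) measurable_const
      · have := rate_mem (c := c) (w := w j) (hx j).1 u
        rw [Real.norm_eq_abs, abs_of_nonneg] <;> split_ifs
        exacts [this.2, (hx j).1, this.1, le_rfl]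
  simp_rw [hinner]
  refine (integral_subtype (measurableSet_Icc (a := (0 : ℝ)) (b := 1))
    fun s => rate c (x i) (w i) s * w i *
        ∏ j ∈ Finset.univ.erase i, (1 - ∫ u in (0 : ℝ)..s, rate c (x j) (w j) u)).trans ?_
  rw [integral_Icc_eq_integral_Ioc, intervalIntegral.integral_of_le zero_le_one]

end DecreasingPrice

/-! ### Expected gain from processing one vertex -/

namespace QCGraph

section Bits

variable {A B : Type*} (G : QCGraph A B)

/-- Conditioning on the bit of `e`, on which neither branch depends otherwise. -/
theorem integral_bitLaw_ite [DecidableEq A] [DecidableEq B] (e : G.Edge)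
    {f g : (G.Edge → Bool) → ℝ} (hf : ∀ ω b, f (Function.update ω e b) = f ω)
    (hg : ∀ ω b, g (Function.update ω e b) = g ω) :
    ∫ ω, (if ω e then f ω else g ω) ∂G.bitLaw =
      G.prob e * ∫ ω, f ω ∂G.bitLaw + (1 - G.prob e) * ∫ ω, g ω ∂G.bitLaw := by
  rw [bitLaw, integral_pi_update _ Integrable.of_finite e, integral_bernoulliMeasure]
  simp [hf, hg]

end Bits

variable {A B : Type*} [DecidableEq A] [DecidableEq B] (G : QCGraph A B) (x : G.Edge → ℝ)

/-- The weight of the output of a strategy. -/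
def gain (T : QueryTree G.Edge) (ω : G.Edge → Bool) : ℝ := ∑ e ∈ T.output ω, G.weight e

/-- The expected gain of a strategy that depends on independent coins. -/
noncomputable def coinGain (T : (G.Edge → Bool) → QueryTree G.Edge) : ℝ :=
  ∫ coin, ∫ ω, G.gain (T coin) ω ∂G.bitLaw ∂G.bitLaw

theorem coinGain_query {T₁ T₂ : (G.Edge → Bool) → QueryTree G.Edge} (e : G.Edge)
    (h₁ : ∀ coin ω b, (T₁ coin).output (Function.update ω e b) = (T₁ coin).output ω)
    (h₂ : ∀ coin ω b, (T₂ coin).output (Function.update ω e b) = (T₂ coin).output ω)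
    (he : ∀ coin ω, e ∉ (T₁ coin).output ω) :
    G.coinGain (fun coin => .query e (T₁ coin) (T₂ coin)) =
      G.prob e * (G.weight e + G.coinGain T₁) + (1 - G.prob e) * G.coinGain T₂ := by
  have h : ∀ coin, ∫ ω, G.gain (.query e (T₁ coin) (T₂ coin)) ω ∂G.bitLaw =
      G.prob e * (G.weight e + ∫ ω, G.gain (T₁ coin) ω ∂G.bitLaw) +
        (1 - G.prob e) * ∫ ω, G.gain (T₂ coin) ω ∂G.bitLaw := by
    intro coin
    have hg : ∀ ω, G.gain (.query e (T₁ coin) (T₂ coin)) ω =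
        if ω e then G.weight e + G.gain (T₁ coin) ω else G.gain (T₂ coin) ω := by
      intro ω
      rw [gain, QueryTree.output]
      split_ifs
      · rw [Finset.sum_insert (he coin ω), gain]
      · rfl
    simp_rw [hg]
    rw [G.integral_bitLaw_ite e (fun ω b => by rw [gain, gain, h₁])
      fun ω b => by rw [gain, gain, h₂], integral_add (integrable_const _) Integrable.of_finite]
    simp
  simp only [coinGain, h]
  rw [integral_add Integrable.of_finite Integrable.of_finite, integral_const_mul,
    integral_const_mul, integral_add (integrable_const _) Integrable.of_finite]
  simp

theorem coinGain_ite {T₁ T₂ : (G.Edge → Bool) → QueryTree G.Edge} (e : G.Edge)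
    (h₁ : ∀ coin ω b, (T₁ (Function.update coin e b)).output ω = (T₁ coin).output ω)
    (h₂ : ∀ coin ω b, (T₂ (Function.update coin e b)).output ω = (T₂ coin).output ω) :
    G.coinGain (fun coin => if coin e then T₁ coin else T₂ coin) =
      G.prob e * G.coinGain T₁ + (1 - G.prob e) * G.coinGain T₂ := by
  have h : ∀ coin : G.Edge → Bool, ∫ ω, G.gain (if coin e then T₁ coin else T₂ coin) ω ∂G.bitLaw =
      if coin e then ∫ ω, G.gain (T₁ coin) ω ∂G.bitLaw else ∫ ω, G.gain (T₂ coin) ω ∂G.bitLaw := by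
    intro coin; split_ifs <;> rfl
  simp only [coinGain, h]
  exact G.integral_bitLaw_ite e (fun ω b => by simp only [gain, h₁])
    fun ω b => by simp only [gain, h₂]

/-- Processing a vertex is worth as much as selecting an edge `e` with probability
`G.pickProb l e`, and adding it to the matching if this is admissible. -/
theorem coinGain_processVertex {t : ℝ} {M : Finset G.Edge}
    {next : (G.Edge → Bool) → Finset G.Edge → QueryTree G.Edge} {l : List G.Edge} (hl : l.Nodup)
    (hω : ∀ e ∈ l, ∀ coin ω b M,
      (next coin M).output (Function.update ω e b) = (next coin M).output ω)
    (hcoin : ∀ e ∈ l, ∀ coin ω b M,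
      (next (Function.update coin e b) M).output ω = (next coin M).output ω)
    (hmem : ∀ e ∈ l, ∀ coin ω, e ∉ (next coin (insert e M)).output ω) :
    G.coinGain (fun coin => G.processVertex x coin t M (next coin) l) =
      G.coinGain (fun coin => next coin M) + ∑ e, G.pickProb l e *
        (if (1 - Real.exp (t - 1)) * G.basePrice x (right e) ≤ G.weight e ∧
            (∀ e' ∈ M, right e' ≠ right e) then
          G.weight e + G.coinGain (fun coin => next coin (insert e M)) -
            G.coinGain (fun coin => next coin M) else 0) := by
  induction l with
  | nil => simp [processVertex, pickProb]
  | cons e l ih =>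
    rw [List.nodup_cons] at hl
    have ih := ih hl.2 (fun e he => hω e (List.mem_cons_of_mem _ he))
      (fun e he => hcoin e (List.mem_cons_of_mem _ he))
      fun e he => hmem e (List.mem_cons_of_mem _ he)
    have hω := hω e List.mem_cons_self
    have hcoin := hcoin e List.mem_cons_self
    have hmem := hmem e List.mem_cons_self
    have hne : ∀ e' ∈ l, e' ≠ e := by rintro e' he' rfl; exact hl.1 he'
    set δ : G.Edge → ℝ := fun e =>
      if (1 - Real.exp (t - 1)) * G.basePrice x (right e) ≤ G.weight e ∧
          (∀ e' ∈ M, right e' ≠ right e) then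
        G.weight e + G.coinGain (fun coin => next coin (insert e M)) -
          G.coinGain (fun coin => next coin M) else 0 with hδ
    -- Querying and flipping the coin both stop with probability p_e, so both cases below obey this
    -- same recursion; they differ only in δ e.
    have hsum : ∑ e', G.pickProb (e :: l) e' * δ e' =
        G.prob e * δ e + (1 - G.prob e) * ∑ e', G.pickProb l e' * δ e' := by
      have hterm : ∀ e', G.pickProb (e :: l) e' * δ e' =
          (if e = e' then G.prob e * δ e else 0) +
            (1 - G.prob e) * (G.pickProb l e' * δ e') := by
        intro e'
        rw [pickProb]
        split_ifs with h
        · subst h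
          simp [pickProb_of_notMem hl.1]
        · ring
      simp_rw [hterm]
      rw [Finset.sum_add_distrib, ← Finset.mul_sum]
      simp
    rw [hsum]
    by_cases h : (1 - Real.exp (t - 1)) * G.basePrice x (right e) ≤ G.weight e ∧
        (∀ e' ∈ M, right e' ≠ right e)
    · simp only [processVertex, if_pos h]
      rw [G.coinGain_query e (fun coin ω b => hω coin ω b _) (fun coin ω b => ?_) hmem, ih]
      · simp only [hδ, if_pos h]
        ring
      · refine G.processVertex_output_congr x (fun M => hω coin ω b M) fun e' he' => ⟨rfl, ?_⟩
        rw [Function.update_of_ne (hne e' he')]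
    · simp only [processVertex, if_neg h]
      rw [G.coinGain_ite e (fun coin ω b => hcoin coin ω b _) (fun coin ω b => ?_), ih]
      · simp only [hδ, if_neg h]
        ring
      · refine G.processVertex_output_congr x (fun M => hcoin coin ω b M) fun e' he' => ⟨?_, rfl⟩
        rw [Function.update_of_ne (hne e' he')]

variable [Fintype A] (D : ∀ a, PMF (G.EdgeOrder a))

/-- The expected gain of a strategy that depends on independent orders and coins. -/
noncomputable def orderGain (T : (∀ a, G.EdgeOrder a) → (G.Edge → Bool) → QueryTree G.Edge) : ℝ :=
  ∫ σ, G.coinGain (T σ) ∂Measure.pi fun a => (D a).toMeasure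

/-- Functions of different coordinates are uncorrelated under a product measure. -/
theorem integral_order_mul {a : A} (f : G.EdgeOrder a → ℝ) {g : (∀ a, G.EdgeOrder a) → ℝ}
    (hg : ∀ σ s, g (Function.update σ a s) = g σ) :
    ∫ σ, f (σ a) * g σ ∂(Measure.pi fun a => (D a).toMeasure) =
      (∫ s, f s ∂(D a).toMeasure) * ∫ σ, g σ ∂(Measure.pi fun a => (D a).toMeasure) := by
  rw [integral_pi_update _ Integrable.of_finite a]
  simp only [Function.update_self, hg, integral_const_mul, integral_mul_const]

end QCGraph

/-! ### Decomposition over the vertices b and the final bound -/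

namespace QCGraph

section PairValue

variable {A B : Type*} [DecidableEq A] [DecidableEq B] {G : QCGraph A B}

/-- The values at pairs of vertices of a function on edges, extended by zero. -/
def pairValue (f : G.Edge → ℝ) (a : A) (b : B) : ℝ :=
  if h : (a, b) ∈ G.edges then f ⟨(a, b), h⟩ else 0

theorem pairValue_edge (f : G.Edge → ℝ) (e : G.Edge) : pairValue f (left e) (right e) = f e :=
  dif_pos e.2

theorem pairValue_mul (f g : G.Edge → ℝ) (a : A) (b : B) :
    pairValue f a b * pairValue g a b = pairValue (fun e => f e * g e) a b := by
  by_cases h : (a, b) ∈ G.edges <;> simp [pairValue, h]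

theorem pairValue_nonneg {f : G.Edge → ℝ} (hf : ∀ e, 0 ≤ f e) (a : A) (b : B) :
    0 ≤ pairValue f a b := by
  rw [pairValue]
  split_ifs
  exacts [hf _, le_rfl]

variable [Fintype A] [Fintype B]

theorem sum_edge_eq_sum_pairValue (f : G.Edge → ℝ) : ∑ e, f e = ∑ a, ∑ b, pairValue f a b := by
  rw [← Fintype.sum_prod_type' (pairValue f)]
  refine Fintype.sum_of_injective Subtype.val Subtype.val_injective _ _ (fun p hp => ?_)
    fun e => (pairValue_edge f e).symm
  exact dif_neg fun h => hp ⟨⟨p, h⟩, rfl⟩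

theorem sum_ite_left_eq (f : G.Edge → ℝ) (a : A) :
    (∑ e : G.Edge, if left e = a then f e else 0) = ∑ b, pairValue f a b := by
  rw [sum_edge_eq_sum_pairValue, Finset.sum_eq_single a]
  · exact Finset.sum_congr rfl fun b _ => by simp [pairValue]
  · exact fun a' _ ha' => Finset.sum_eq_zero fun b _ => by simp [pairValue, ha']
  · simp

theorem sum_incident_right (f : G.Edge → ℝ) (b : B) :
    ∑ e ∈ G.incident (.inr b), f e = ∑ a, pairValue f a b := by
  rw [incident, Finset.sum_filter, sum_edge_eq_sum_pairValue]
  refine Finset.sum_congr rfl fun a _ => ?_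
  rw [Finset.sum_eq_single b]
  · simp [pairValue]
  · exact fun b' _ hb' => by simp [pairValue, hb']
  · simp

end PairValue

section ArrivalOrder

variable {A : Type*} [Fintype A]

/-- The order in which the vertices are handled. -/
noncomputable def arrivalOrder (t : A → unitInterval) : List A :=
  (Finset.univ : Finset A).toList.mergeSort fun a a' => decide (t a ≤ t a')

theorem nodup_arrivalOrder (t : A → unitInterval) : (arrivalOrder t).Nodup :=
  (List.mergeSort_perm _ _).nodup_iff.2 (Finset.nodup_toList _)

theorem pairwise_arrivalOrder (t : A → unitInterval) :
    (arrivalOrder t).Pairwise fun a a' => t a ≤ t a' := by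
  have := List.pairwise_mergeSort (le := fun a a' => decide (t a ≤ t a'))
    (fun a b c hab hbc => by simp only [decide_eq_true_eq] at *; exact hab.trans hbc)
    (fun a b => by simpa using le_total _ _) (Finset.univ : Finset A).toList
  simpa [arrivalOrder] using this

theorem toFinset_arrivalOrder [DecidableEq A] (t : A → unitInterval) :
    (arrivalOrder t).toFinset = Finset.univ := by
  ext a
  simp [arrivalOrder, (List.mergeSort_perm _ _).mem_iff]

end ArrivalOrder

variable {A B : Type*} [DecidableEq A] [DecidableEq B] [Fintype A] [Fintype B] (G : QCGraph A B)
  (x : G.Edge → ℝ) (D : ∀ a, PMF (G.EdgeOrder a))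

/-- The expected value of the edge selected at `b` if the vertices `L` arrive at times `t`. -/
noncomputable def vertexSale (t : A → unitInterval) (b : B) (L : List A) : ℝ :=
  DecreasingPrice.saleValue
    (fun a => DecreasingPrice.rate (G.basePrice x b) (pairValue x a b) (pairValue G.weight a b) (t a))
    (fun a => pairValue G.weight a b) L

theorem sum_free_insert {M : Finset G.Edge} {e : G.Edge} (he : ∀ e' ∈ M, right e' ≠ right e)
    (V : B → ℝ) :
    (∑ b, if ∀ e' ∈ insert e M, right e' ≠ b then V b else 0) =
      (∑ b, if ∀ e' ∈ M, right e' ≠ b then V b else 0) - V (right e) := by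
  have hterm : ∀ b, (if ∀ e' ∈ insert e M, right e' ≠ b then V b else 0) =
      (if ∀ e' ∈ M, right e' ≠ b then V b else 0) - if right e = b then V b else 0 := by
    intro b
    simp only [Finset.forall_mem_insert]
    by_cases hb : right e = b
    · subst hb
      simp only [ne_eq, not_true_eq_false, false_and, if_false, if_true]
      rw [if_pos (by simpa using he), sub_self]
    · simp [hb]
  simp_rw [hterm, Finset.sum_sub_distrib]
  simp

/-- The future is worth a sum over free vertices b of separate sale values. Selecting e = (a, b)
earns w(e) and destroys exactly the value of b, so the marginal gain depends on b alone; averaging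
over D_a puts x_e in front of it, which is the recursion of `saleValue`. -/
theorem orderGain_processAll (hD : ∀ a, G.IsPermDist x a (D a)) (t : A → unitInterval) {L : List A}
    (hL : L.Nodup) {M : Finset G.Edge} (hM : ∀ e ∈ M, left e ∉ L) :
    G.orderGain D (fun σ coin => G.processAll x coin t σ L M) =
      ∑ b, if ∀ e ∈ M, right e ≠ b then G.vertexSale x t b L else 0 := by
  induction L generalizing M with
  | nil =>
    simp [processAll, orderGain, coinGain, gain, QueryTree.output, vertexSale,
      DecreasingPrice.saleValue]
  | cons a L ih =>
    rw [List.nodup_cons] at hL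
    have ih := fun M hM => ih hL.2 (M := M) hM
    have hML : ∀ e ∈ M, left e ∉ L := fun e he h => hM e he (List.mem_cons_of_mem _ h)
    have hML' : ∀ e : G.Edge, left e = a → ∀ e' ∈ insert e M, left e' ∉ L := by
      intro e he e' he'
      rcases Finset.mem_insert.1 he' with rfl | he'
      · rw [he]
        exact hL.1
      · exact hML e' he'
    set C : Finset G.Edge → (∀ a, G.EdgeOrder a) → ℝ := fun M σ =>
      G.coinGain fun coin => G.processAll x coin t σ L M with hC
    -- The order at a is not used after a, so selection at a is independent of the continuation.
    have hCupd : ∀ M σ s, C M (Function.update σ a s) = C M σ := by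
      intro M σ s
      have h : ∀ coin ω, (G.processAll x coin t (Function.update σ a s) L M).output ω =
          (G.processAll x coin t σ L M).output ω := fun coin ω =>
        G.processAll_output_congr x (fun a' ha' => Function.update_of_ne
          (by rintro rfl; exact hL.1 ha') _ _) (fun _ _ => ⟨rfl, rfl⟩) M
      simp only [hC, coinGain, gain, h]
    have hCint : ∀ M, ∫ σ, C M σ ∂(Measure.pi fun a => (D a).toMeasure) =
      G.orderGain D (fun σ coin => G.processAll x coin t σ L M) := fun M => rfl
    set acc : G.Edge → Prop := fun e =>
      (1 - Real.exp (t a - 1)) * G.basePrice x (right e) ≤ G.weight e ∧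
        (∀ e' ∈ M, right e' ≠ right e) with hacc
    have hstep : ∀ σ, G.coinGain (fun coin => G.processAll x coin t σ (a :: L) M) =
        C M σ + ∑ e, G.pickProb (σ a).1 e *
          (if acc e then G.weight e + C (insert e M) σ - C M σ else 0) := by
      intro σ
      refine G.coinGain_processVertex x (next := fun coin M' => G.processAll x coin t σ L M')
        (σ a).2.1 ?_ ?_ ?_
      · refine fun e he coin ω b M => G.processAll_output_congr x (fun _ _ => rfl)
          (fun e' he' => ⟨rfl, Function.update_of_ne ?_ _ _⟩) M
        rintro rfl
        exact hL.1 ((σ a).left_eq he ▸ he')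
      · refine fun e he coin ω b M => G.processAll_output_congr x (fun _ _ => rfl)
          (fun e' he' => ⟨Function.update_of_ne ?_ _ _, rfl⟩) M
        rintro rfl
        exact hL.1 ((σ a).left_eq he ▸ he')
      · intro e he coin ω hmem
        exact ((G.processAll_commits x hL.2 (hML' e ((σ a).left_eq he))).disjoint_output G ω hmem
          (Finset.mem_insert_self e M)).1 rfl
    have hpick : ∀ e, ∫ s, G.pickProb s.1 e ∂(D a).toMeasure = if left e = a then x e else 0 := by
      intro e
      split_ifs with h
      · exact (hD a).integral_pickProb (by simpa [incident] using h)
      · have h0 : ∀ s : G.EdgeOrder a, G.pickProb s.1 e = 0 := fun s =>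
          pickProb_of_notMem fun he => h (s.left_eq he)
        simp [h0]
    have hexp : ∀ e, ∫ σ, G.pickProb (σ a).1 e *
          (if acc e then G.weight e + C (insert e M) σ - C M σ else 0)
          ∂(Measure.pi fun a => (D a).toMeasure) =
        if left e = a then x e * (if acc e then G.weight e - G.vertexSale x t (right e) L else 0)
          else 0 := by
      intro e
      rw [G.integral_order_mul D (fun s => G.pickProb s.1 e) (fun σ s => by rw [hCupd, hCupd]),
        hpick]
      split_ifs with h₁ h₂
      · congr 1
        rw [integral_sub Integrable.of_finite Integrable.of_finite,
          integral_add (integrable_const _) Integrable.of_finite, hCint, hCint, ih M hML,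
          ih (insert e M) (hML' e h₁), G.sum_free_insert h₂.2]
        simp
        ring
      · simp
      · simp
      · simp
    -- Passing from edges to pairs: non-edges become buyers of rate 0, and the price test is
    -- absorbed into `rate`.
    have hval : ∀ b, pairValue (fun e => x e *
          (if acc e then G.weight e - G.vertexSale x t (right e) L else 0)) a b =
        if ∀ e ∈ M, right e ≠ b then DecreasingPrice.rate (G.basePrice x b) (pairValue x a b)
          (pairValue G.weight a b) (t a) * (pairValue G.weight a b - G.vertexSale x t b L)
        else 0 := by
      intro b
      by_cases h : (a, b) ∈ G.edges
      · simp only [pairValue, dif_pos h, hacc, DecreasingPrice.rate]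
        split_ifs <;> first | rfl | tauto | simp
      · simp [pairValue, h, DecreasingPrice.rate]
    rw [orderGain]
    simp_rw [hstep]
    rw [integral_add Integrable.of_finite Integrable.of_finite,
      integral_finsetSum _ fun _ _ => Integrable.of_finite, hCint, ih M hML]
    simp_rw [hexp]
    rw [sum_ite_left_eq]
    simp_rw [hval]
    rw [← Finset.sum_add_distrib]
    refine Finset.sum_congr rfl fun b _ => ?_
    split_ifs
    · rfl
    · simp

theorem utility_approxQC (hD : ∀ a, G.IsPermDist x a (D a)) :
    Integrable (fun t : A → unitInterval => ∑ b, G.vertexSale x t b (arrivalOrder t))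
      (Measure.pi fun _ => volume) ∧
    G.utility (G.approxQC x D) =
      ∫ t : A → unitInterval, ∑ b, G.vertexSale x t b (arrivalOrder t)
        ∂Measure.pi fun _ => volume := by
  have hm := G.measurable_approxQCStrategy x
  have hint : Integrable (fun r => G.treeUtility (G.approxQCStrategy x r))
      ((Measure.pi fun _ : A => (volume : Measure unitInterval)).prod
        ((Measure.pi fun a => (D a).toMeasure).prod G.bitLaw)) :=
    (G.integrable_treeUtility _).comp_measurable hm
  have hinner : ∀ t : A → unitInterval,
      ∫ s, G.treeUtility (G.approxQCStrategy x (t, s))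
        ∂((Measure.pi fun a => (D a).toMeasure).prod G.bitLaw) =
      ∑ b, G.vertexSale x t b (arrivalOrder t) := by
    intro t
    rw [integral_prod _ Integrable.of_finite]
    have h := G.orderGain_processAll x D hD t (nodup_arrivalOrder t) (M := ∅) (by simp)
    simp only [Finset.notMem_empty, false_imp_iff, implies_true, if_true] at h
    exact h
  constructor
  · have := hint.integral_prod_left
    simpa only [hinner] using this
  · rw [utility_eq, approxQC, integral_map hm.aemeasurable
      G.measurable_treeUtility.aestronglyMeasurable, integral_prod _ hint]
    simp only [hinner]

theorem le_utility_approxQC (hx : G.IsLPOptimal x) (hD : ∀ a, G.IsPermDist x a (D a)) :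
    (1 - 1 / Real.exp 1) * ∑ e, x e * G.weight e ≤ G.utility (G.approxQC x D) := by
  obtain ⟨hint, hU⟩ := G.utility_approxQC x D hD
  have hX0 : ∀ a b, 0 ≤ pairValue x a b := pairValue_nonneg hx.1.2
  have hXW : ∀ a b, 0 ≤ pairValue x a b * pairValue G.weight a b := fun a b => by
    rw [pairValue_mul]
    exact pairValue_nonneg hx.mul_weight_nonneg a b
  -- On the B side only the constraint F = E_b is used, weakened through f ≤ 1.
  have hXsum : ∀ b, ∑ a, pairValue x a b ≤ 1 := fun b => by
    rw [← sum_incident_right]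
    exact (hx.1.1 (.inr b) _ subset_rfl).trans (G.existProb_le_one _)
  have hX1 : ∀ a b, 0 ≤ pairValue x a b ∧ pairValue x a b ≤ 1 := fun a b =>
    ⟨hX0 a b, (Finset.single_le_sum (fun a _ => hX0 a b) (Finset.mem_univ a)).trans (hXsum b)⟩
  have hprice : ∀ b, G.basePrice x b = ∑ a, pairValue x a b * pairValue G.weight a b := fun b => by
    simp_rw [pairValue_mul]
    rw [basePrice, sum_incident_right]
  have hbound : ∀ b a, Integrable (fun t => DecreasingPrice.saleBound (G.basePrice x b)
      (fun a => pairValue x a b) (fun a => pairValue G.weight a b) t a)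
      (Measure.pi fun _ : A => volume) := fun b a =>
    DecreasingPrice.integrable_saleBound (fun a => hX1 a b) a
  calc (1 - 1 / Real.exp 1) * ∑ e, x e * G.weight e
      = ∑ b, (1 - 1 / Real.exp 1) * G.basePrice x b := by
        rw [sum_edge_eq_sum_pairValue, Finset.sum_comm, ← Finset.mul_sum]
        simp_rw [hprice, pairValue_mul]
    _ ≤ ∑ b, ∑ a, ∫ t, DecreasingPrice.saleBound (G.basePrice x b) (fun a => pairValue x a b)
          (fun a => pairValue G.weight a b) t a ∂(Measure.pi fun _ : A => volume) := by
        refine Finset.sum_le_sum fun b _ => ?_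
        simp_rw [DecreasingPrice.integral_saleBound (fun a => hX1 a b)]
        exact DecreasingPrice.le_sum_integral_rate (fun a => hX0 a b) (fun a => hXW a b) (hXsum b)
          (hprice b)
    _ = ∫ t, ∑ b, ∑ a, DecreasingPrice.saleBound (G.basePrice x b) (fun a => pairValue x a b)
          (fun a => pairValue G.weight a b) t a ∂(Measure.pi fun _ : A => volume) := by
        rw [integral_finsetSum _ fun b _ => integrable_finsetSum _ fun a _ => hbound b a]
        exact Finset.sum_congr rfl fun b _ => (integral_finsetSum _ fun a _ => hbound b a).symm
    _ ≤ ∫ t, ∑ b, G.vertexSale x t b (arrivalOrder t) ∂(Measure.pi fun _ : A => volume) := by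
        refine integral_mono (integrable_finsetSum _ fun b _ => integrable_finsetSum _
          fun a _ => hbound b a) hint fun t => Finset.sum_le_sum fun b _ => ?_
        have := DecreasingPrice.le_saleValue (w := fun a => pairValue G.weight a b)
          (q := fun a => DecreasingPrice.rate (G.basePrice x b) (pairValue x a b)
            (pairValue G.weight a b) (t a))
          (fun a => ⟨(DecreasingPrice.rate_mem (hX0 a b) _).1,
            (DecreasingPrice.rate_mem (hX0 a b) _).2.trans (hX1 a b).2⟩)
          (fun a => by
            rw [DecreasingPrice.rate]
            split_ifs
            · exact hXW a b
            · rw [zero_mul])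
          (nodup_arrivalOrder t) (pairwise_arrivalOrder t)
        rwa [toFinset_arrivalOrder] at this
    _ = G.utility (G.approxQC x D) := hU.symm

end QCGraph

theorem mainTheorem1 {A B : Type*} [Fintype A] [Fintype B] [DecidableEq A] [DecidableEq B]
    (G : QCGraph A B) :
    IsGreatest G.utilities G.opt ∧
    (∃ (x : G.Edge → ℝ) (D : ∀ a, PMF (G.EdgeOrder a)),
      G.IsLPOptimal x ∧ ∀ a, G.IsPermDist x a (D a)) ∧
    ∀ (x : G.Edge → ℝ) (D : ∀ a, PMF (G.EdgeOrder a)),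
      G.IsLPOptimal x → (∀ a, G.IsPermDist x a (D a)) →
        G.IsQueryCommit (G.approxQC x D) ∧
          (1 - 1 / Real.exp 1) * G.opt ≤ G.utility (G.approxQC x D) := by
  refine ⟨G.exists_opt_eq_treeUtility.1, ?_, fun x D hx hD => ⟨G.isQueryCommit_approxQC x D, ?_⟩⟩
  · obtain ⟨x, hx⟩ := G.exists_isLPOptimal
    choose D hD using fun a => QCGraph.exists_isPermDist hx.1 a
    exact ⟨x, D, hx, hD⟩
  · refine le_trans (mul_le_mul_of_nonneg_left (QCGraph.opt_le_of_isLPOptimal hx) ?_)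
      (G.le_utility_approxQC x D hx hD)
    rw [sub_nonneg, div_le_one (Real.exp_pos 1)]
    exact Real.one_le_exp zero_le_one
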